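/- Let $q\in\mathbb{C}$ with $|q|<1$. Write $(a;q)_n=\prod_{j=0}^{n-1}(1-aq^j)$, $(a;q)_\infty=\prod_{j\ge 0}(1-aq^j)$ and $(a,b,c;q)_\infty=(a;q)_\infty(b;q)_\infty(c;q)_\infty$. For nonnegative integers $n_1,\dots,n_k$ put $N_j=n_j+n_{j+1}+\cdots+n_k$ for $1\le j\le k$ and $N_j=0$ for $j>k$. Let $k\ge 1$ and $1\le i\le k+1$ be integers, and abbreviate $$Q_i=N_1^2+\cdots+N_k^2+N_i+N_{i+1}+\cdots+N_k$$ (the linear part being $0$ for $i=k+1$). Then each of the following multiple series, summed over all nonnegative integer values of the indicated variables, converges absolutely and has the stated value. (1) $\displaystyle\sum_{m,n_1,\dots,n_k\ge 0}\frac{q^{\binom{m+1}{2}+mn_1+2Q_i}}{(q;q)_m(q;q)_{n_1}(q^2;q^2)_{n_2}\cdots(q^2;q^2)_{n_k}}=\frac{(q^{2i},q^{4k+6-2i},q^{4k+6};q^{4k+6})_\infty}{(q;q)_\infty}.$ (2) $\displaystyle\sum_{m,n_1,\dots,n_k\ge 0}\frac{q^{\binom{m+1}{2}+mn_k+2Q_i}}{(q;q)_m(q^2;q^2)_{n_1}\cdots(q^2;q^2)_{n_{k-1}}(q;q)_{n_k}}=\frac{(q^{2i},q^{4k+6-2i},q^{4k+6};q^{4k+6})_\infty}{(q;q)_\infty}.$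 (3) $\displaystyle\sum_{m_1,m_2,n_1,\dots,n_k\ge 0}\frac{q^{\binom{m_1+1}{2}+m_1m_2+2\binom{m_2+1}{2}+2m_2n_1+4Q_i}}{(q;q)_{m_1}(q;q)_{m_2}(q^2;q^2)_{n_1}(q^4;q^4)_{n_2}\cdots(q^4;q^4)_{n_k}}=\frac{(q^{4i},q^{8k+12-4i},q^{8k+12};q^{8k+12})_\infty}{(q;q)_\infty}.$ (4) With $n_1:=n_{1,1}+2n_{1,2}$, $\displaystyle\sum_{m,n_{1,1},n_{1,2},n_2,\dots,n_k\ge 0}\frac{q^{\binom{m+1}{2}+mn_1+\binom{n_{1,1}}{2}+2Q_i}}{(q;q)_m(q;q)_{n_{1,1}}(q^2;q^2)_{n_{1,2}}(q^2;q^2)_{n_2}\cdots(q^2;q^2)_{n_k}}=\frac{(q^{2i},q^{4k+6-2i},q^{4k+6};q^{4k+6})_\infty}{(q;q)_\infty}.$ (5) $\displaystyle\sum_{m_1,m_2,n_1,\dots,n_k\ge 0}\frac{q^{\binom{m_1+1}{2}+m_1n_1+2\binom{m_2+1}{2}+2m_2n_1+4Q_i}}{(q;q)_{m_1}(q^2;q^2)_{m_2}(q;q)_{n_1}(q^4;q^4)_{n_2}\cdots(q^4;q^4)_{n_k}}=\frac{(q^{4i},q^{8k+12-4i},q^{8k+12};q^{8k+12})_\infty}{(q;q)_\infty}.$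 (6) $\displaystyle\sum_{m_1,m_2,n_1,\dots,n_k\ge 0}\frac{q^{\binom{m_1}{2}+\binom{m_1+2m_2+1}{2}+(m_1+2m_2)n_1+2Q_i}}{(q;q)_{m_1}(q^2;q^2)_{m_2}(q;q)_{n_1}(q^2;q^2)_{n_2}\cdots(q^2;q^2)_{n_k}}=\frac{(q^{2i},q^{4k+6-2i},q^{4k+6};q^{4k+6})_\infty}{(q;q)_\infty}.$ (7) With $n_k:=n_{k,1}+2n_{k,2}$, $\displaystyle\sum_{n_1,\dots,n_{k-1},n_{k,1},n_{k,2}\ge 0}\frac{q^{\binom{n_{k,1}}{2}+Q_i}}{(q;q)_{n_1}\cdots(q;q)_{n_{k-1}}(q;q)_{n_{k,1}}(q^2;q^2)_{n_{k,2}}}=\frac{(q^{i},q^{2k+3-i},q^{2k+3};q^{2k+3})_\infty}{(q;q)_\infty}.$ (8) With $n_1:=n_{1,1}+2n_{1,2}$, $\displaystyle\sum_{n_{1,1},n_{1,2},n_2,\dots,n_k\ge 0}\frac{q^{\binom{n_{1,1}}{2}+Q_i}}{(q;q)_{n_{1,1}}(q^2;q^2)_{n_{1,2}}(q;q)_{n_2}\cdots(q;q)_{n_k}}=\frac{(q^{i},q^{2k+3-i},q^{2k+3};q^{2k+3})_\infty}{(q;q)_\infty}.$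 (9), (10) With $n_1:=n_{1,1}+n_{1,2}$, for $s=1$ and for $s=2$ respectively, $\displaystyle\sum_{m,n_{1,1},n_{1,2},n_2,\dots,n_k\ge 0}\frac{q^{\binom{m+1}{2}+mn_{1,1}+n_{1,1}^2+n_{1,2}^2-n_{1,s}-\binom{n_1}{2}+Q_i}}{(q;q)_m(q;q)_{n_{1,1}}(q^2;q^2)_{n_{1,2}}(q;q)_{n_2}\cdots(q;q)_{n_k}}=\frac{(-q;q)_\infty(q^{i},q^{2k+3-i},q^{2k+3};q^{2k+3})_\infty}{(q;q)_\infty}.$ -/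

import Mathlib

open Finset

/-- The finite `q`-Pochhammer symbol `(a;q)_n = (1 - a)(1 - aq)⋯(1 - aq^(n-1))`. -/
noncomputable def qPoch (a q : ℂ) (n : ℕ) : ℂ := ∏ j ∈ range n, (1 - a * q ^ j)

/-- The infinite `q`-Pochhammer symbol `(a;q)_∞ = ∏_{j ≥ 0} (1 - aq^j)`, for `|q| < 1`. -/
noncomputable def qPochInf (a q : ℂ) : ℂ := ∏' j : ℕ, (1 - a * q ^ j)

/-- For `|q| < 1` the product defining `(a;q)_∞` converges to it. -/
theorem hasProd_qPochInf (a : ℂ) {q : ℂ} (hq : ‖q‖ < 1) :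
    HasProd (fun j : ℕ => 1 - a * q ^ j) (qPochInf a q) := by
  have h : Multipliable (fun j : ℕ => 1 + (-(a * q ^ j))) := by
    apply multipliable_one_add_of_summable
    simp only [norm_neg, norm_mul, norm_pow]
    exact (summable_geometric_of_lt_one (norm_nonneg q) hq).mul_left _
  simp only [← sub_eq_add_neg] at h
  exact h.hasProd

/-- The compressed symbol `(a, b, c; q)_∞ = (a;q)_∞ (b;q)_∞ (c;q)_∞`. -/
noncomputable def qPochInf₃ (a b c q : ℂ) : ℂ := qPochInf a q * qPochInf b q * qPochInf c q

/-- `N_j = n_j + n_{j+1} + ⋯ + n_k` for a vector `n = (n_1, …, n_k)`; it is `0` for `j > k`.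
The entry `n_l` (indices from `1`) is the value of `n` at the element `l - 1` of `Fin k`. -/
def partialN {k : ℕ} (n : Fin k → ℕ) (j : ℕ) : ℕ := ∑ l : Fin k with j ≤ l.val + 1, n l

/-- The exponent `N_1² + ⋯ + N_k² + N_i + N_{i+1} + ⋯ + N_k` for `n = (n_1, …, n_k)`. -/
def agExponent {k : ℕ} (i : ℕ) (n : Fin k → ℕ) : ℕ :=
  ∑ j ∈ Icc 1 k, partialN n j ^ 2 + ∑ j ∈ Icc i k, partialN n j

/-- The vector `(a, t_1, …, t_r)`. -/
def consVec {r : ℕ} (a : ℕ) (t : Fin r → ℕ) : Fin (r + 1) → ℕ := Fin.cons a t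

/-- The vector `(t_1, …, t_r, a)`. -/
def snocVec {r : ℕ} (t : Fin r → ℕ) (a : ℕ) : Fin (r + 1) → ℕ := Fin.snoc t a

section AndrewsGordon

open Filter Topology

/-! All ten series reduce to the Andrews-Gordon identity `hasSum_agTerm` in base q, q² or q⁴ once
the auxiliary variables are summed out. Euler's expansion (`hasSum_euler`) sums a variable m coupled
to n and leaves (-q;q)_∞ / (-q;q)_n. Since (q;q)_n (-q;q)_n = (q²;q²)_n, a factor 1/(q;q)_n becomes
1/(q²;q²)_n, and (-q;q)_∞ / (q²;q²)_∞ = 1/(q;q)_∞ repairs the right side. A split n = a + 2b is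
undone by (-X;q)_∞ / (X²;q²)_∞ = 1/(X;q)_∞, and a split n = a + b by (-X;q²)_∞ (-qX;q²)_∞ = (-X;q)_∞
(`hasSum_of_add_two_mul`, `hasSum_of_add`). The Andrews-Gordon identity comes from Bailey's chain.
Truncated by 1/(q;q)_{N-N_1}, the series satisfies a recursion in k whose kernels reproduce
themselves up to a power of q (`sum_mul_baileyA`, `sum_mul_baileyB`). Starting from the unit Bailey
pair this yields the closed form `agClosed`. As N tends to infinity the closed form becomes a theta
series, evaluated by `jacobi_triple_product`. -/

theorem qPoch_zero (a q : ℂ) : qPoch a q 0 = 1 := by simp [qPoch]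

theorem qPoch_succ (a q : ℂ) (n : ℕ) : qPoch a q (n + 1) = qPoch a q n * (1 - a * q ^ n) := by
  simp [qPoch, prod_range_succ]

theorem qPoch_self_succ (q : ℂ) (n : ℕ) :
    qPoch q q (n + 1) = qPoch q q n * (1 - q ^ (n + 1)) := by
  rw [qPoch_succ, pow_succ']

/-! ### Non-vanishing and limits of q-Pochhammer symbols. -/

theorem norm_pow_lt_one {q : ℂ} (hq : ‖q‖ < 1) {n : ℕ} (hn : n ≠ 0) : ‖q ^ n‖ < 1 := by
  rw [norm_pow]
  exact pow_lt_one₀ (norm_nonneg q) hq hn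

theorem one_sub_pow_ne_zero {q : ℂ} (hq : ‖q‖ < 1) {n : ℕ} (hn : n ≠ 0) : 1 - q ^ n ≠ 0 := by
  intro h
  have := norm_pow_lt_one hq hn
  rw [← sub_eq_zero.mp h] at this
  simp at this

theorem one_sub_mul_pow_ne_zero {a q : ℂ} (ha : ‖a‖ < 1) (hq : ‖q‖ < 1) (n : ℕ) :
    1 - a * q ^ n ≠ 0 := by
  intro h
  have h2 : ‖a * q ^ n‖ < 1 := by
    rw [norm_mul, norm_pow]
    exact mul_lt_one_of_nonneg_of_lt_one_left (norm_nonneg a) ha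
      (pow_le_one₀ (norm_nonneg q) hq.le)
  rw [← sub_eq_zero.mp h] at h2
  simp at h2

theorem qPoch_ne_zero {a q : ℂ} (ha : ‖a‖ < 1) (hq : ‖q‖ < 1) (n : ℕ) : qPoch a q n ≠ 0 :=
  prod_ne_zero_iff.mpr fun j _ => one_sub_mul_pow_ne_zero ha hq j

theorem tendsto_qPoch (a : ℂ) {q : ℂ} (hq : ‖q‖ < 1) :
    Tendsto (qPoch a q) atTop (𝓝 (qPochInf a q)) :=
  (hasProd_qPochInf a hq).tendsto_prod_nat

theorem qPochInf_ne_zero {a q : ℂ} (ha : ‖a‖ < 1) (hq : ‖q‖ < 1) : qPochInf a q ≠ 0 := by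
  have := tprod_one_add_ne_zero_of_summable (f := fun j : ℕ => -(a * q ^ j))
    (fun j => by simpa [← sub_eq_add_neg] using one_sub_mul_pow_ne_zero ha hq j)
    (by
      simp only [norm_neg, norm_mul, norm_pow]
      exact (summable_geometric_of_lt_one (norm_nonneg q) hq).mul_left _)
  simpa [qPochInf, ← sub_eq_add_neg] using this

/-! ### Absolute convergence by comparison with geometric series. -/

/-- `u` is bounded away from zero (or vanishes), in the sense that its inverse is bounded. -/
def InvBounded {X : Type*} (u : X → ℂ) : Prop := ∃ C : ℝ, ∀ x, ‖(u x)⁻¹‖ ≤ C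

theorem invBounded_qPoch {a q : ℂ} (ha : ‖a‖ < 1) (hq : ‖q‖ < 1) : InvBounded (qPoch a q) := by
  have h := ((tendsto_qPoch a hq).inv₀ (qPochInf_ne_zero ha hq)).norm
  obtain ⟨C, hC⟩ := h.bddAbove_range
  exact ⟨C, fun n => hC ⟨n, rfl⟩⟩

theorem InvBounded.comp {X Y : Type*} {u : X → ℂ} (hu : InvBounded u) (g : Y → X) :
    InvBounded fun y => u (g y) :=
  hu.imp fun _ hC y => hC (g y)

theorem InvBounded.mul {X : Type*} {u v : X → ℂ} (hu : InvBounded u) (hv : InvBounded v) :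
    InvBounded fun x => u x * v x := by
  obtain ⟨C, hC⟩ := hu
  obtain ⟨D, hD⟩ := hv
  refine ⟨C * D, fun x => ?_⟩
  rw [mul_inv, norm_mul]
  exact mul_le_mul (hC x) (hD x) (norm_nonneg _) ((norm_nonneg _).trans (hC x))

theorem InvBounded.prod_pi {k : ℕ} {u : ℕ → ℂ} (hu : InvBounded u) :
    InvBounded fun n : Fin k → ℕ => ∏ l, u (n l) := by
  obtain ⟨C, hC⟩ := hu
  refine ⟨C ^ k, fun n => ?_⟩
  rw [← prod_inv_distrib, norm_prod]
  calc _ ≤ ∏ _l : Fin k, C := prod_le_prod (fun _ _ => norm_nonneg _) fun l _ => hC (n l)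
    _ = C ^ k := by simp

theorem summable_pow_add {X Y : Type*} {r : ℝ} (hr : 0 ≤ r) {u : X → ℕ} {v : Y → ℕ}
    (hu : Summable fun x => r ^ u x) (hv : Summable fun y => r ^ v y) :
    Summable fun p : X × Y => r ^ (u p.1 + v p.2) := by
  simp only [pow_add]
  exact hu.mul_of_nonneg hv (fun _ => pow_nonneg hr _) fun _ => pow_nonneg hr _

theorem summable_pow_sum_pi {r : ℝ} (hr : 0 ≤ r) (hr1 : r < 1) (k : ℕ) :
    Summable fun n : Fin k → ℕ => r ^ ∑ l, n l := by
  induction k with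
  | zero => exact Summable.of_finite
  | succ k ih =>
    rw [← (Fin.consEquiv fun _ : Fin (k + 1) => ℕ).summable_iff]
    refine (summable_pow_add (u := id) hr (summable_geometric_of_lt_one hr hr1) ih).congr ?_
    rintro ⟨a, t⟩
    simp [Fin.consEquiv, Fin.sum_univ_succ]

theorem summable_pow_div {X : Type*} {q : ℂ} (hq : ‖q‖ < 1) {w e : X → ℕ} {D : X → ℂ}
    (hw : Summable fun x => ‖q‖ ^ w x) (he : ∀ x, w x ≤ e x) (hD : InvBounded D) :
    Summable fun x => q ^ e x / D x := by
  obtain ⟨C, hC⟩ := hD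
  refine Summable.of_norm_bounded (hw.mul_right C) fun x => ?_
  rw [div_eq_mul_inv, norm_mul, norm_pow]
  exact mul_le_mul (pow_le_pow_of_le_one (norm_nonneg q) hq.le (he x)) (hC x) (norm_nonneg _)
    (pow_nonneg (norm_nonneg q) _)

/-- The existential exponent lets unification read it off the series at each use, so that only the
bound by the weight `w` is left to check. -/
theorem summable_of_eq_pow_div {X : Type*} {q : ℂ} (hq : ‖q‖ < 1) {f D : X → ℂ} {w : X → ℕ}
    (hw : Summable fun x => ‖q‖ ^ w x) (hD : InvBounded D)
    (h : ∀ x, ∃ e, w x ≤ e ∧ f x = q ^ e / D x) : Summable f := by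
  choose e he hf using h
  exact (summable_pow_div hq hw he hD).congr fun x => (hf x).symm

/-! ### Truncated reciprocals and a q-Vandermonde sum. -/

/-- `1 / (q;q)_{N-s}`, understood as `0` for `s > N`. -/
noncomputable def invPoch (q : ℂ) (N s : ℕ) : ℂ := if s ≤ N then (qPoch q q (N - s))⁻¹ else 0

theorem invPoch_add (q : ℂ) (a s : ℕ) : invPoch q (a + s) s = (qPoch q q a)⁻¹ := by
  simp [invPoch]

theorem invPoch_of_lt {q : ℂ} {N s : ℕ} (h : N < s) : invPoch q N s = 0 := by
  simp [invPoch, h]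

theorem inv_qPoch_self_succ {q : ℂ} (hq : ‖q‖ < 1) (n : ℕ) :
    (1 - q ^ (n + 1)) * (qPoch q q (n + 1))⁻¹ = (qPoch q q n)⁻¹ := by
  have h1 := one_sub_pow_ne_zero hq (Nat.succ_ne_zero n)
  rw [qPoch_self_succ, mul_inv, mul_comm, mul_assoc, inv_mul_cancel₀ h1, mul_one]

theorem one_sub_mul_invPoch {q : ℂ} (hq : ‖q‖ < 1) {N s : ℕ} (h : s ≤ N) :
    (1 - q ^ (N - s)) * invPoch q N s = invPoch q N (s + 1) := by
  obtain ⟨d, rfl⟩ := Nat.exists_eq_add_of_le' h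
  cases d with
  | zero => simp [invPoch]
  | succ d =>
    rw [invPoch_add, show d + 1 + s = d + (s + 1) by ring, invPoch_add,
      show d + (s + 1) - s = d + 1 by omega, inv_qPoch_self_succ hq]

theorem norm_invPoch_le {q : ℂ} {C : ℝ} (hC : ∀ n, ‖(qPoch q q n)⁻¹‖ ≤ C) (N s : ℕ) :
    ‖invPoch q N s‖ ≤ C := by
  unfold invPoch
  split_ifs
  · exact hC _
  · simpa using (norm_nonneg _).trans (hC 0)

theorem tendsto_invPoch {q : ℂ} (hq : ‖q‖ < 1) (s : ℕ) :
    Tendsto (fun N => invPoch q N s) atTop (𝓝 (qPochInf q q)⁻¹) := by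
  rw [← tendsto_add_atTop_iff_nat s]
  simp only [invPoch_add]
  exact (tendsto_qPoch q hq).inv₀ (qPochInf_ne_zero hq hq)

/-- A q-Chu-Vandermonde sum. Split 1 - q^(M+1) as (1 - q^(M+1-t)) + q^(M+1-t) (1 - q^t): the first
piece is the sum for M with the same c, the second, after shifting t, the sum for M with c + 1. -/
theorem sum_pow_sq_div_qPoch {q : ℂ} (hq : ‖q‖ < 1) (M c : ℕ) :
    ∑ t ∈ range (M + 1), q ^ (t ^ 2 + c * t) *
      ((qPoch q q (M - t))⁻¹ * (qPoch q q t)⁻¹ * (qPoch q q (t + c))⁻¹) =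
    (qPoch q q M)⁻¹ * (qPoch q q (M + c))⁻¹ := by
  induction M generalizing c with
  | zero => simp [qPoch_zero]
  | succ M ih =>
    have h1 := one_sub_pow_ne_zero hq (Nat.succ_ne_zero M)
    apply mul_left_cancel₀ h1
    rw [← mul_assoc, inv_qPoch_self_succ hq, mul_sum]
    have hsplit : ∀ t ∈ range (M + 1 + 1), (1 - q ^ (M + 1)) * (q ^ (t ^ 2 + c * t) *
        ((qPoch q q (M + 1 - t))⁻¹ * (qPoch q q t)⁻¹ * (qPoch q q (t + c))⁻¹)) =
        (1 - q ^ (M + 1 - t)) * (q ^ (t ^ 2 + c * t) *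
        ((qPoch q q (M + 1 - t))⁻¹ * (qPoch q q t)⁻¹ * (qPoch q q (t + c))⁻¹)) +
        q ^ (M + 1 - t) * (1 - q ^ t) * (q ^ (t ^ 2 + c * t) *
        ((qPoch q q (M + 1 - t))⁻¹ * (qPoch q q t)⁻¹ * (qPoch q q (t + c))⁻¹)) := by
      intro t ht
      have : q ^ (M + 1) = q ^ (M + 1 - t) * q ^ t := by
        rw [← pow_add]; congr 1; have := mem_range.mp ht; omega
      rw [this]; ring
    rw [sum_congr rfl hsplit, sum_add_distrib]
    have hA : ∑ t ∈ range (M + 1 + 1), (1 - q ^ (M + 1 - t)) * (q ^ (t ^ 2 + c * t) *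
        ((qPoch q q (M + 1 - t))⁻¹ * (qPoch q q t)⁻¹ * (qPoch q q (t + c))⁻¹)) =
        (qPoch q q M)⁻¹ * (qPoch q q (M + c))⁻¹ := by
      rw [sum_range_succ, ← ih c]
      simp only [Nat.sub_self, pow_zero, sub_self, zero_mul, add_zero]
      refine sum_congr rfl fun t ht => ?_
      have ht := mem_range.mp ht
      rw [← inv_qPoch_self_succ hq (M - t), show M - t + 1 = M + 1 - t by omega]
      ring
    have hB : ∑ t ∈ range (M + 1 + 1), q ^ (M + 1 - t) * (1 - q ^ t) * (q ^ (t ^ 2 + c * t) *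
        ((qPoch q q (M + 1 - t))⁻¹ * (qPoch q q t)⁻¹ * (qPoch q q (t + c))⁻¹)) =
        q ^ (M + 1 + c) * ((qPoch q q M)⁻¹ * (qPoch q q (M + (c + 1)))⁻¹) := by
      rw [sum_range_succ', ← ih (c + 1), mul_sum]
      simp only [pow_zero, sub_self, mul_zero, zero_mul, add_zero]
      refine sum_congr rfl fun t ht => ?_
      have ht := mem_range.mp ht
      rw [← inv_qPoch_self_succ hq t, show M + 1 - (t + 1) = M - t by omega,
        show t + 1 + c = t + (c + 1) by ring]
      have : q ^ (M + 1 + c) * q ^ (t ^ 2 + (c + 1) * t) =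
          q ^ (M - t) * q ^ ((t + 1) ^ 2 + c * (t + 1)) := by
        rw [← pow_add, ← pow_add]; congr 1
        zify [show t ≤ M by omega]; ring
      linear_combination (-(1 - q ^ (t + 1)) * ((qPoch q q (M - t))⁻¹ *
        (qPoch q q (t + 1))⁻¹ * (qPoch q q (t + (c + 1)))⁻¹)) * this
    rw [hA, hB, ← inv_qPoch_self_succ hq (M + c), show M + 1 + c = M + c + 1 by ring,
      show M + (c + 1) = M + c + 1 by ring]
    ring

/-! ### Bailey kernels relative to a = 1 and a = q. -/

/-- The kernel `1 / ((q;q)_{N-m} (q;q)_{N+m})`, zero for `m > N`. -/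
noncomputable def baileyA (q : ℂ) (N m : ℕ) : ℂ := invPoch q N m * (qPoch q q (N + m))⁻¹

/-- The kernel `1 / ((q;q)_{N-m} (q;q)_{N+m+1})`, zero for `m > N`. -/
noncomputable def baileyB (q : ℂ) (N m : ℕ) : ℂ := invPoch q N m * (qPoch q q (N + m + 1))⁻¹

/-- The previous sum shifted by s = m + t. Truncated subtraction is harmless because `invPoch q s m`
vanishes for s < m. -/
theorem sum_pow_mul_invPoch_mul {q : ℂ} (hq : ‖q‖ < 1) (N m c : ℕ) :
    ∑ s ∈ range (N + 1), q ^ ((s - m) ^ 2 + c * (s - m)) *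
      (invPoch q N s * (invPoch q s m * (qPoch q q (s - m + c))⁻¹)) =
    invPoch q N m * (qPoch q q (N - m + c))⁻¹ := by
  rcases lt_or_ge N m with h | h
  · rw [invPoch_of_lt h, zero_mul]
    refine sum_eq_zero fun s hs => ?_
    rw [invPoch_of_lt (show s < m by have := mem_range.mp hs; omega)]
    ring
  · obtain ⟨M, rfl⟩ := Nat.exists_eq_add_of_le' h
    rw [show M + m + 1 = m + (M + 1) by ring, sum_range_add, invPoch_add, Nat.add_sub_cancel,
      ← sum_pow_sq_div_qPoch hq M c, sum_eq_zero, zero_add]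
    · refine sum_congr rfl fun t ht => ?_
      have ht := mem_range.mp ht
      have : invPoch q (M + m) (m + t) = (qPoch q q (M - t))⁻¹ := by
        rw [show M + m = (M - t) + (m + t) by omega, invPoch_add]
      rw [this, add_comm m t, invPoch_add, Nat.add_sub_cancel]
      ring
    · intro s hs
      rw [invPoch_of_lt (mem_range.mp hs)]
      ring

/-- Bailey's lemma in its limiting case, for a = 1: with s = m + t one has s² = m² + (t² + 2mt), so
c = 2m in the shifted sum. The companion for a = q takes c = 2m + 1. -/
theorem sum_mul_baileyA {q : ℂ} (hq : ‖q‖ < 1) (N m : ℕ) :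
    ∑ s ∈ range (N + 1), q ^ (s ^ 2) * invPoch q N s * baileyA q s m =
      q ^ (m ^ 2) * baileyA q N m := by
  rcases lt_or_ge N m with h | h
  · rw [baileyA, invPoch_of_lt h, zero_mul, mul_zero]
    refine sum_eq_zero fun s hs => ?_
    rw [baileyA, invPoch_of_lt (show s < m by have := mem_range.mp hs; omega)]
    ring
  have := sum_pow_mul_invPoch_mul hq N m (2 * m)
  rw [baileyA, show N + m = N - m + 2 * m by omega, ← this, mul_sum]
  refine sum_congr rfl fun s _ => ?_
  rcases lt_or_ge s m with h2 | h2
  · rw [baileyA, invPoch_of_lt h2]; ring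
  · obtain ⟨d, rfl⟩ := Nat.exists_eq_add_of_le' h2
    rw [baileyA, Nat.add_sub_cancel, show d + m + m = d + 2 * m by ring,
      show (d + m) ^ 2 = m ^ 2 + (d ^ 2 + 2 * m * d) by ring, pow_add]
    ring

theorem sum_mul_baileyB {q : ℂ} (hq : ‖q‖ < 1) (N m : ℕ) :
    ∑ s ∈ range (N + 1), q ^ (s ^ 2 + s) * invPoch q N s * baileyB q s m =
      q ^ (m ^ 2 + m) * baileyB q N m := by
  rcases lt_or_ge N m with h | h
  · rw [baileyB, invPoch_of_lt h, zero_mul, mul_zero]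
    refine sum_eq_zero fun s hs => ?_
    rw [baileyB, invPoch_of_lt (show s < m by have := mem_range.mp hs; omega)]
    ring
  have := sum_pow_mul_invPoch_mul hq N m (2 * m + 1)
  rw [baileyB, show N + m + 1 = N - m + (2 * m + 1) by omega, ← this, mul_sum]
  refine sum_congr rfl fun s _ => ?_
  rcases lt_or_ge s m with h2 | h2
  · rw [baileyB, invPoch_of_lt h2]; ring
  · obtain ⟨d, rfl⟩ := Nat.exists_eq_add_of_le' h2
    rw [baileyB, Nat.add_sub_cancel, show d + m + m + 1 = d + (2 * m + 1) by ring,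
      show (d + m) ^ 2 + (d + m) = m ^ 2 + m + (d ^ 2 + (2 * m + 1) * d) by ring, pow_add]
    ring

/-- The passage between a = q and a = 1, needed because the levels with exponent s² + s act on
`baileyB` and those with s² on `baileyA`. -/
theorem baileyA_sub_baileyA_succ {q : ℂ} (hq : ‖q‖ < 1) {N m : ℕ} (h : m ≤ N) :
    baileyA q N m - q ^ (2 * m + 1) * baileyA q N (m + 1) =
      (1 - q ^ (2 * m + 1)) * baileyB q N m := by
  rw [baileyA, baileyA, baileyB, ← one_sub_mul_invPoch hq h, ← inv_qPoch_self_succ hq (N + m),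
    ← add_assoc]
  have : q ^ (N + m + 1) = q ^ (2 * m + 1) * q ^ (N - m) := by
    rw [← pow_add]; congr 1; omega
  rw [this]
  ring

theorem choose_two_succ (n : ℕ) : (n + 1).choose 2 = n.choose 2 + n := by
  rw [Nat.choose_succ_succ' n 1, Nat.choose_one_right, add_comm]

/-- The unit Bailey pair relative to `a = q`: partial sums in closed form. -/
theorem one_sub_mul_sum_baileyB {q : ℂ} (hq : ‖q‖ < 1) {N n : ℕ} (h : n ≤ N) :
    (1 - q ^ N) * ∑ m ∈ range (n + 1),
      (-1) ^ m * q ^ m.choose 2 * ((1 - q ^ (2 * m + 1)) * baileyB q N m) =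
    (-1) ^ n * q ^ (n + 1).choose 2 * (1 - q ^ (n + 1)) *
      (invPoch q N (n + 1) * (qPoch q q (N + n + 1))⁻¹) := by
  induction n with
  | zero =>
    rw [← one_sub_mul_invPoch hq h]
    simp [baileyB]
    ring
  | succ n ih =>
    rw [sum_range_succ, mul_add, ih (by omega), baileyB, ← one_sub_mul_invPoch hq h,
      ← inv_qPoch_self_succ hq (N + n + 1), choose_two_succ (n + 1),
      show N + (n + 1) + 1 = N + n + 1 + 1 by ring]
    obtain ⟨d, rfl⟩ := Nat.exists_eq_add_of_le' h
    rw [Nat.add_sub_cancel]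
    ring

/-- At n = N the closed form contains `invPoch q N (N + 1) = 0`. The case N = 0 is apart because
there the factor 1 - q^N cannot be cancelled. -/
theorem sum_baileyB_eq_ite {q : ℂ} (hq : ‖q‖ < 1) (N : ℕ) :
    ∑ m ∈ range (N + 1), (-1) ^ m * q ^ m.choose 2 * ((1 - q ^ (2 * m + 1)) * baileyB q N m) =
      if N = 0 then 1 else 0 := by
  split_ifs with h
  · subst h
    have := inv_qPoch_self_succ hq 0
    simpa [baileyB, invPoch, qPoch_zero] using this
  · have := one_sub_mul_sum_baileyB hq (le_refl N)
    rw [invPoch_of_lt (Nat.lt_succ_self N), zero_mul, mul_zero] at this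
    exact (mul_eq_zero.mp this).resolve_left (one_sub_pow_ne_zero hq h)

/-! ### Recursion and lower bounds for the quadratic exponent. -/

theorem partialN_one {k : ℕ} (n : Fin k → ℕ) : partialN n 1 = ∑ l, n l := by
  simp [partialN]

theorem partialN_cons_one {k : ℕ} (a : ℕ) (t : Fin k → ℕ) :
    partialN (consVec a t) 1 = a + ∑ l, t l := by
  simp [partialN_one, consVec, Fin.sum_univ_succ]

theorem partialN_cons_succ {k : ℕ} (a : ℕ) (t : Fin k → ℕ) (j : ℕ) :
    partialN (consVec a t) (j + 2) = partialN t (j + 1) := by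
  simp [partialN, consVec, sum_filter, Fin.sum_univ_succ]

theorem sum_Icc_partialN_cons {k : ℕ} (a : ℕ) (t : Fin k → ℕ) (f : ℕ → ℕ) (i : ℕ) :
    ∑ j ∈ Icc (i + 2) (k + 1), f (partialN (consVec a t) j) =
      ∑ j ∈ Icc (i + 1) k, f (partialN t j) := by
  rw [← sum_map (Icc (i + 1) k) (addRightEmbedding 1)
    (fun j => f (partialN (consVec a t) j)) |>.trans (sum_congr rfl fun j hj => ?_),
    map_add_right_Icc]
  obtain ⟨j, rfl⟩ := Nat.exists_eq_add_of_le' (show 1 ≤ j by have := mem_Icc.mp hj; omega)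
  exact congrArg f (partialN_cons_succ a t j)

theorem sum_Icc_one_partialN_cons {k : ℕ} (a : ℕ) (t : Fin k → ℕ) (f : ℕ → ℕ) :
    ∑ j ∈ Icc 1 (k + 1), f (partialN (consVec a t) j) =
      f (a + ∑ l, t l) + ∑ j ∈ Icc 1 k, f (partialN t j) := by
  rw [← add_sum_Ioc_eq_sum_Icc (Nat.succ_le_succ (Nat.zero_le k)), partialN_cons_one,
    ← sum_Icc_partialN_cons a t f 0]
  rfl

theorem agExponent_one_cons {k : ℕ} (a : ℕ) (t : Fin k → ℕ) :
    agExponent 1 (consVec a t) =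
      (a + ∑ l, t l) ^ 2 + (a + ∑ l, t l) + agExponent 1 t := by
  rw [agExponent, agExponent, sum_Icc_one_partialN_cons a t (fun x => x ^ 2),
    sum_Icc_one_partialN_cons a t (fun x => x)]
  ring

theorem agExponent_succ_cons {k : ℕ} (i a : ℕ) (t : Fin k → ℕ) :
    agExponent (i + 2) (consVec a t) = (a + ∑ l, t l) ^ 2 + agExponent (i + 1) t := by
  rw [agExponent, agExponent, sum_Icc_one_partialN_cons a t (fun x => x ^ 2),
    sum_Icc_partialN_cons a t (fun x => x)]
  ring

theorem sq_sum_le_agExponent {k : ℕ} (i : ℕ) (n : Fin k → ℕ) :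
    (∑ l, n l) ^ 2 ≤ agExponent i n := by
  cases k with
  | zero => simp
  | succ k =>
    rw [← partialN_one, agExponent]
    exact le_add_right
      (single_le_sum (f := fun j => partialN n j ^ 2) (fun _ _ => Nat.zero_le _) (by simp))

theorem sum_le_agExponent {k : ℕ} (i : ℕ) (n : Fin k → ℕ) : ∑ l, n l ≤ agExponent i n :=
  (Nat.le_self_pow two_ne_zero _).trans (sq_sum_le_agExponent i n)

/-! ### The truncated Andrews-Gordon series in closed form. -/

/-- The general term of the Andrews-Gordon series. -/
noncomputable def agTerm (q : ℂ) {k : ℕ} (i : ℕ) (n : Fin k → ℕ) : ℂ :=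
  q ^ agExponent i n / ∏ l, qPoch q q (n l)

theorem summable_agTerm {q : ℂ} (hq : ‖q‖ < 1) (k i : ℕ) :
    Summable fun n : Fin k → ℕ => agTerm q i n :=
  summable_pow_div hq (summable_pow_sum_pi (norm_nonneg q) hq k) (sum_le_agExponent i)
    (invBounded_qPoch hq hq).prod_pi

theorem summable_agTerm_mul_invPoch {q : ℂ} (hq : ‖q‖ < 1) (k i N : ℕ) :
    Summable fun n : Fin k → ℕ => agTerm q i n * invPoch q N (∑ l, n l) := by
  obtain ⟨C, hC⟩ := invBounded_qPoch hq hq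
  refine Summable.of_norm_bounded ((summable_agTerm hq k i).norm.mul_right C) fun n => ?_
  rw [norm_mul]
  exact mul_le_mul_of_nonneg_left (norm_invPoch_le hC _ _) (norm_nonneg _)

/-- Peeling off the first variable of a truncated multiple series, in terms of `s = N_1`. -/
theorem hasSum_cons_of_hasSum {q : ℂ} (hq : ‖q‖ < 1) {k i i' N : ℕ} {e : ℕ → ℕ} {G : ℕ → ℂ}
    (he : ∀ a (t : Fin k → ℕ),
      agExponent i (consVec a t) = e (a + ∑ l, t l) + agExponent i' t)
    (hG : ∀ s, HasSum (fun t : Fin k → ℕ => agTerm q i' t * invPoch q s (∑ l, t l)) (G s)) :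
    HasSum (fun n : Fin (k + 1) → ℕ => agTerm q i n * invPoch q N (∑ l, n l))
      (∑ s ∈ range (N + 1), q ^ e s * invPoch q N s * G s) := by
  -- In the variables s = a + ∑ t and t, the factor 1/(q;q)_a is `invPoch q s (∑ t)`. It vanishes
  -- for s < ∑ t, so the sum extends from the image of the injection `φ` to all pairs (s, t).
  obtain ⟨H, hH⟩ : ∃ H : ℕ × (Fin k → ℕ) → ℂ, ∀ s t, H (s, t) =
      q ^ e s * invPoch q N s * (agTerm q i' t * invPoch q s (∑ l, t l)) :=
    ⟨fun p => q ^ e p.1 * invPoch q N p.1 * (agTerm q i' p.2 * invPoch q p.1 (∑ l, p.2 l)),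
      fun _ _ => rfl⟩
  obtain ⟨φ, hφ'⟩ : ∃ φ : ℕ × (Fin k → ℕ) → ℕ × (Fin k → ℕ), ∀ a t, φ (a, t) =
      (a + ∑ l, t l, t) := ⟨fun p => (p.1 + ∑ l, p.2 l, p.2), fun _ _ => rfl⟩
  have hφ : Function.Injective φ := by
    rintro ⟨a, t⟩ ⟨b, u⟩ h
    simp only [hφ', Prod.mk.injEq] at h
    obtain ⟨h, rfl⟩ := h
    simpa using h
  have hrange : ∀ x ∉ Set.range φ, H x = 0 := by
    rintro ⟨s, t⟩ hx
    have : s < ∑ l, t l := by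
      by_contra hs
      exact hx ⟨(s - ∑ l, t l, t), by rw [hφ', Nat.sub_add_cancel (not_lt.mp hs)]⟩
    rw [hH, invPoch_of_lt this, mul_zero, mul_zero]
  have hcomp : (fun n : Fin (k + 1) → ℕ => agTerm q i n * invPoch q N (∑ l, n l)) ∘
      (Fin.consEquiv fun _ : Fin (k + 1) => ℕ) = H ∘ φ := by
    ext ⟨a, t⟩
    have h1 := he a t
    simp only [consVec] at h1
    simp only [Function.comp, Fin.consEquiv, Equiv.coe_fn_mk, agTerm, hφ', hH, Fin.sum_univ_succ,
      Fin.prod_univ_succ, Fin.cons_zero, Fin.cons_succ, h1, invPoch_add, pow_add, div_eq_mul_inv,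
      mul_inv]
    ring
  have hsum : Summable H := by
    rw [← hφ.summable_iff hrange, ← hcomp, Equiv.summable_iff]
    exact summable_agTerm_mul_invPoch hq _ _ _
  rw [← (Fin.consEquiv fun _ : Fin (k + 1) => ℕ).hasSum_iff, hcomp, hφ.hasSum_iff hrange]
  have h2 : HasSum (fun s => q ^ e s * invPoch q N s * G s) (∑' p, H p) :=
    hsum.hasSum.prod_fiberwise fun s => by simpa only [hH] using (hG s).mul_left _
  have h3 : HasSum (fun s => q ^ e s * invPoch q N s * G s)
      (∑ s ∈ range (N + 1), q ^ e s * invPoch q N s * G s) :=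
    hasSum_sum_of_ne_finset_zero fun s hs => by
      rw [invPoch_of_lt (by simpa using hs)]; ring
  rw [h3.unique h2]
  exact hsum.hasSum

/-- The numerator sequence of the Bailey pair behind the Andrews-Gordon identity. -/
noncomputable def agAlpha (q : ℂ) (k i m : ℕ) : ℂ :=
  -- The unit pair gives the binomial exponent. Each of the k + 2 - i steps with `baileyB` adds m² +
  -- m: one produces 1/(q;q)_N, the others belong to N_i, …, N_k. Each of the i - 1 steps with
  -- `baileyA`, for N_1, …, N_{i-1}, adds m².
  (-1) ^ m * q ^ (m.choose 2 + (k + 2 - i) * (m ^ 2 + m) + (i - 1) * m ^ 2)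

/-- The closed form of the truncated Andrews-Gordon series. -/
noncomputable def agClosed (q : ℂ) (k i N : ℕ) : ℂ :=
  ∑ m ∈ range (N + 1),
    agAlpha q k i m * (baileyA q N m - q ^ (i * (2 * m + 1)) * baileyA q N (m + 1))

/-- A range independent of N allows the sums over s and m to be interchanged. -/
theorem agClosed_eq_sum {q : ℂ} {k i N L : ℕ} (h : N ≤ L) :
    agClosed q k i N = ∑ m ∈ range (L + 1),
      agAlpha q k i m * (baileyA q N m - q ^ (i * (2 * m + 1)) * baileyA q N (m + 1)) := by
  refine sum_subset (range_subset_range.mpr (by omega)) fun m _ hm => ?_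
  have hm : N < m := by simpa using hm
  rw [baileyA, baileyA, invPoch_of_lt hm, invPoch_of_lt (by omega)]
  ring

/-- For i = 1 the two `baileyA` terms fold into one `baileyB` term, to which the step with exponent
s² + s applies. -/
theorem agClosed_one {q : ℂ} (hq : ‖q‖ < 1) {k N L : ℕ} (h : N ≤ L) :
    agClosed q k 1 N = ∑ m ∈ range (L + 1),
      (-1) ^ m * q ^ (m.choose 2 + (k + 1) * (m ^ 2 + m)) *
        ((1 - q ^ (2 * m + 1)) * baileyB q N m) := by
  rw [agClosed_eq_sum h]
  refine sum_congr rfl fun m _ => ?_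
  rcases le_or_gt m N with h1 | h1
  · rw [← baileyA_sub_baileyA_succ hq h1, agAlpha]
    simp
  · rw [baileyA, baileyA, baileyB, invPoch_of_lt h1, invPoch_of_lt (by omega)]
    ring

theorem sum_agClosed_one {q : ℂ} (hq : ‖q‖ < 1) (k N : ℕ) :
    ∑ s ∈ range (N + 1), q ^ (s ^ 2 + s) * invPoch q N s * agClosed q k 1 s =
      agClosed q (k + 1) 1 N := by
  rw [agClosed_one hq le_rfl]
  have h : ∀ s ∈ range (N + 1), q ^ (s ^ 2 + s) * invPoch q N s * agClosed q k 1 s =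
      ∑ m ∈ range (N + 1), (-1) ^ m * q ^ (m.choose 2 + (k + 1) * (m ^ 2 + m)) *
        (1 - q ^ (2 * m + 1)) * (q ^ (s ^ 2 + s) * invPoch q N s * baileyB q s m) := by
    intro s hs
    rw [agClosed_one hq (show s ≤ N by have := mem_range.mp hs; omega), mul_sum]
    exact sum_congr rfl fun m _ => by ring
  rw [sum_congr rfl h, sum_comm]
  refine sum_congr rfl fun m _ => ?_
  rw [← mul_sum, sum_mul_baileyB hq]
  ring

/-- The step multiplies `baileyA q s m` by q^(m²) and its neighbour by q^((m+1)²). The ratio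
q^(2m+1) of these powers is what raises i by one. -/
theorem sum_agClosed_succ {q : ℂ} (hq : ‖q‖ < 1) {k i : ℕ} (hi : 1 ≤ i) (N : ℕ) :
    ∑ s ∈ range (N + 1), q ^ (s ^ 2) * invPoch q N s * agClosed q k i s =
      agClosed q (k + 1) (i + 1) N := by
  have h : ∀ s ∈ range (N + 1), q ^ (s ^ 2) * invPoch q N s * agClosed q k i s =
      ∑ m ∈ range (N + 1), agAlpha q k i m *
        (q ^ (s ^ 2) * invPoch q N s * baileyA q s m -
          q ^ (i * (2 * m + 1)) * (q ^ (s ^ 2) * invPoch q N s * baileyA q s (m + 1))) := by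
    intro s hs
    rw [agClosed_eq_sum (show s ≤ N by have := mem_range.mp hs; omega), mul_sum]
    exact sum_congr rfl fun m _ => by ring
  rw [sum_congr rfl h, sum_comm, agClosed]
  refine sum_congr rfl fun m _ => ?_
  rw [← mul_sum, sum_sub_distrib, ← mul_sum, sum_mul_baileyA hq, sum_mul_baileyA hq, agAlpha,
    agAlpha]
  obtain ⟨i, rfl⟩ := Nat.exists_eq_add_of_le' hi
  rw [show k + 1 + 2 - (i + 1 + 1) = k + 2 - (i + 1) by omega, Nat.add_sub_cancel,
    Nat.add_sub_cancel]
  ring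

/-- One Bailey step applied to the unit pair: the sum over s collapses to s = 0, which contributes
1/(q;q)_N. -/
theorem agClosed_zero {q : ℂ} (hq : ‖q‖ < 1) (N : ℕ) :
    agClosed q 0 1 N = (qPoch q q N)⁻¹ := by
  have h : ∀ s ∈ range (N + 1), q ^ (s ^ 2 + s) * invPoch q N s * (if s = 0 then 1 else 0) =
      ∑ m ∈ range (N + 1), (-1) ^ m * q ^ m.choose 2 * (1 - q ^ (2 * m + 1)) *
        (q ^ (s ^ 2 + s) * invPoch q N s * baileyB q s m) := by
    intro s hs
    have hs : s < N + 1 := mem_range.mp hs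
    rw [← sum_baileyB_eq_ite hq s, mul_sum]
    refine (sum_congr rfl fun m _ => by ring).trans
      (sum_subset (range_subset_range.mpr (show s + 1 ≤ N + 1 by omega)) fun m _ hm => ?_)
    rw [baileyB, invPoch_of_lt (show s < m by simpa using hm)]
    ring
  have h2 := sum_congr rfl h
  rw [sum_comm] at h2
  rw [agClosed_one hq le_rfl]
  calc _ = ∑ m ∈ range (N + 1), ∑ s ∈ range (N + 1),
        (-1) ^ m * q ^ m.choose 2 * (1 - q ^ (2 * m + 1)) *
          (q ^ (s ^ 2 + s) * invPoch q N s * baileyB q s m) := by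
        refine sum_congr rfl fun m _ => ?_
        rw [← mul_sum, sum_mul_baileyB hq]
        ring
    _ = _ := by
        rw [← h2, sum_range_succ', sum_eq_zero (fun s _ => by simp)]
        simp [invPoch]

/-- Induction on k, with N_1 as the outermost summation variable. If i = 1 its level carries s² + s
and i stays 1; otherwise it carries s² and i drops by one. -/
theorem hasSum_agTerm_mul_invPoch {q : ℂ} (hq : ‖q‖ < 1) {k i : ℕ} (hi : 1 ≤ i)
    (hik : i ≤ k + 1) (N : ℕ) :
    HasSum (fun n : Fin k → ℕ => agTerm q i n * invPoch q N (∑ l, n l))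
      (agClosed q k i N) := by
  induction k generalizing i N with
  | zero =>
    obtain rfl : i = 1 := by omega
    rw [agClosed_zero hq]
    convert hasSum_unique (fun n : Fin 0 → ℕ => agTerm q 1 n * invPoch q N (∑ l, n l)) using 1
    simp [agTerm, agExponent, invPoch]
  | succ k ih =>
    match i, hi with
    | 1, _ =>
      rw [← sum_agClosed_one hq]
      exact hasSum_cons_of_hasSum hq (e := fun s => s ^ 2 + s) agExponent_one_cons
        fun s => ih le_rfl (by omega) s
    | i + 2, _ =>
      rw [← sum_agClosed_succ hq (by omega)]
      exact hasSum_cons_of_hasSum hq (e := fun s => s ^ 2) (agExponent_succ_cons i)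
        fun s => ih (by omega) (by omega) s

/-! ### Finite q-binomial theorem and Jacobi's triple product. -/

theorem sum_qBinomial_eq_prod {q : ℂ} (hq : ‖q‖ < 1) (x y : ℂ) (n : ℕ) :
    ∑ j ∈ range (n + 1), q ^ j.choose 2 * x ^ j * y ^ (n - j) *
      ((qPoch q q j)⁻¹ * (qPoch q q (n - j))⁻¹) =
    (∏ j ∈ range n, (y + x * q ^ j)) * (qPoch q q n)⁻¹ := by
  induction n with
  | zero => simp [qPoch_zero]
  | succ n ih =>
    have h1 := one_sub_pow_ne_zero hq (Nat.succ_ne_zero n)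
    apply mul_left_cancel₀ h1
    rw [mul_left_comm, inv_qPoch_self_succ hq, prod_range_succ, mul_right_comm, ← ih, mul_sum]
    have hsplit : ∀ j ∈ range (n + 1 + 1), (1 - q ^ (n + 1)) * (q ^ j.choose 2 * x ^ j *
        y ^ (n + 1 - j) * ((qPoch q q j)⁻¹ * (qPoch q q (n + 1 - j))⁻¹)) =
        (1 - q ^ (n + 1 - j)) * (q ^ j.choose 2 * x ^ j *
        y ^ (n + 1 - j) * ((qPoch q q j)⁻¹ * (qPoch q q (n + 1 - j))⁻¹)) +
        q ^ (n + 1 - j) * (1 - q ^ j) * (q ^ j.choose 2 * x ^ j *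
        y ^ (n + 1 - j) * ((qPoch q q j)⁻¹ * (qPoch q q (n + 1 - j))⁻¹)) := by
      intro j hj
      have : q ^ (n + 1) = q ^ (n + 1 - j) * q ^ j := by
        rw [← pow_add]; congr 1; have := mem_range.mp hj; omega
      rw [this]; ring
    rw [sum_congr rfl hsplit, sum_add_distrib, mul_add, sum_range_succ, sum_range_succ' _ (n + 1)]
    simp only [Nat.sub_self, pow_zero, sub_self, zero_mul, mul_zero, add_zero]
    congr 1
    · rw [sum_mul]
      refine sum_congr rfl fun j hj => ?_
      have hj := mem_range.mp hj
      rw [← inv_qPoch_self_succ hq (n - j), show n + 1 - j = n - j + 1 by omega]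
      ring
    · rw [sum_mul]
      refine sum_congr rfl fun j hj => ?_
      have hj := mem_range.mp hj
      rw [← inv_qPoch_self_succ hq j, show n + 1 - (j + 1) = n - j by omega, choose_two_succ]
      have : q ^ n = q ^ (n - j) * q ^ j := by
        rw [← pow_add]; congr 1; omega
      rw [this]
      ring

theorem two_mul_choose_two (n : ℕ) : (2 : ℤ) * (n.choose 2 : ℕ) = n ^ 2 - n := by
  induction n with
  | zero => simp
  | succ n ih =>
    rw [choose_two_succ]
    push_cast
    linarith

/-- The q-binomial theorem with 2N factors y + xQ^j, where Q = ab, y = Q^N and x = -b; the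
homogeneous form avoids negative powers. The lower N factors give (a;Q)_N and the upper N give
(b;Q)_N. The terms j = N + m and j = N - 1 - m are the two halves of the bilateral sum. -/
theorem finite_jacobi_triple_product {a b : ℂ} (ha : a ≠ 0) (hb : b ≠ 0) (hab : ‖a * b‖ < 1)
    (N : ℕ) :
    ∑ m ∈ range (N + 1), ((-1) ^ m * b ^ m * (a * b) ^ m.choose 2 * baileyA (a * b) N m -
      (-1) ^ m * a ^ (m + 1) * (a * b) ^ (m + 1).choose 2 * baileyA (a * b) N (m + 1)) =
    qPoch a (a * b) N * qPoch b (a * b) N * (qPoch (a * b) (a * b) (2 * N))⁻¹ := by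
  obtain ⟨Q, hQ⟩ : ∃ Q, Q = a * b := ⟨_, rfl⟩
  have hQ0 : Q ≠ 0 := hQ ▸ mul_ne_zero ha hb
  rw [← hQ] at hab ⊢
  -- The monomial pulled out of the 2N factors.
  have hc : (-b) ^ N * Q ^ (N ^ 2 + N.choose 2) ≠ 0 :=
    mul_ne_zero (pow_ne_zero _ (neg_ne_zero.mpr hb)) (pow_ne_zero _ hQ0)
  apply mul_left_cancel₀ hc
  have hprod : ∏ j ∈ range (2 * N), (Q ^ N + -b * Q ^ j) =
      (-b) ^ N * Q ^ (N ^ 2 + N.choose 2) * (qPoch a Q N * qPoch b Q N) := by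
    have h1 : ∏ j ∈ range N, (Q ^ N + -b * Q ^ j) = (-b) ^ N * Q ^ N.choose 2 * qPoch a Q N := by
      have : ∀ j ∈ range N, Q ^ N + -b * Q ^ j = -b * Q ^ j * (1 - a * Q ^ (N - 1 - j)) := by
        intro j hj
        have : Q ^ N = Q * Q ^ j * Q ^ (N - 1 - j) := by
          rw [← pow_succ', ← pow_add]; congr 1; have := mem_range.mp hj; omega
        rw [this]
        linear_combination (Q ^ j * Q ^ (N - 1 - j)) * hQ
      rw [prod_congr rfl this, prod_mul_distrib, prod_mul_distrib, prod_const, card_range,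
        prod_pow_eq_pow_sum, sum_range_id, ← Nat.choose_two_right,
        prod_range_reflect (fun j => 1 - a * Q ^ j) N]
      rfl
    have h2 : ∏ j ∈ range N, (Q ^ N + -b * Q ^ (N + j)) = Q ^ (N ^ 2) * qPoch b Q N := by
      have : ∀ j ∈ range N, Q ^ N + -b * Q ^ (N + j) = Q ^ N * (1 - b * Q ^ j) :=
        fun j _ => by ring
      rw [prod_congr rfl this, prod_mul_distrib, prod_const, card_range, ← pow_mul, sq]
      rfl
    rw [two_mul, prod_range_add, h1, h2]
    ring
  rw [← mul_assoc, ← hprod, ← sum_qBinomial_eq_prod hab, show 2 * N + 1 = N + (N + 1) by ring,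
    sum_range_add _ N (N + 1), sum_sub_distrib, sum_range_succ (fun m => (-1) ^ m * a ^ (m + 1) *
      Q ^ (m + 1).choose 2 * baileyA Q N (m + 1)) N, baileyA, invPoch_of_lt (Nat.lt_succ_self N),
    zero_mul, mul_zero, add_zero, add_comm (∑ x ∈ range N, _), mul_sub, sub_eq_add_neg,
    ← mul_neg, mul_sum,
    ← sum_range_reflect (fun j => Q ^ j.choose 2 * (-b) ^ j * (Q ^ N) ^ (2 * N - j) *
      ((qPoch Q Q j)⁻¹ * (qPoch Q Q (2 * N - j))⁻¹)) N]
  congr 1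
  · refine sum_congr rfl fun m hm => ?_
    obtain ⟨d, rfl⟩ := Nat.exists_eq_add_of_le' (show m ≤ N by have := mem_range.mp hm; omega)
    rw [baileyA, invPoch_add, show 2 * (d + m) - (d + m + m) = d by omega]
    have : Q ^ (d + m + m).choose 2 * (Q ^ (d + m)) ^ d =
        Q ^ ((d + m) ^ 2 + (d + m).choose 2) * Q ^ m.choose 2 := by
      rw [← pow_mul, ← pow_add, ← pow_add]
      congr 1
      have h1 := two_mul_choose_two (d + m + m)
      have h2 := two_mul_choose_two (d + m)
      have h3 := two_mul_choose_two m
      zify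
      push_cast at h1 h2 h3
      linarith
    rw [neg_pow b, neg_pow b]
    linear_combination (-1) * ((-1) ^ (d + m + m) * b ^ (d + m + m) * ((qPoch Q Q (d + m + m))⁻¹ *
      (qPoch Q Q d)⁻¹)) * this
  · rw [← sum_neg_distrib, mul_sum]
    refine sum_congr rfl fun m hm => ?_
    obtain ⟨d, rfl⟩ := Nat.exists_eq_add_of_le' (show m + 1 ≤ N by have := mem_range.mp hm; omega)
    rw [baileyA, invPoch_add, show d + (m + 1) - 1 - m = d by omega,
      show 2 * (d + (m + 1)) - d = d + (m + 1) + (m + 1) by omega]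
    have : Q ^ d.choose 2 * (Q ^ (d + (m + 1))) ^ (d + (m + 1) + (m + 1)) =
        Q ^ ((d + (m + 1)) ^ 2 + (d + (m + 1)).choose 2) * Q ^ (m + 1).choose 2 * Q ^ (m + 1) := by
      rw [← pow_mul, ← pow_add, ← pow_add, ← pow_add]
      congr 1
      have h1 := two_mul_choose_two d
      have h2 := two_mul_choose_two (d + (m + 1))
      have h3 := two_mul_choose_two (m + 1)
      zify
      push_cast at h1 h2 h3
      linarith
    have hab' : Q ^ (m + 1) = a ^ (m + 1) * b ^ (m + 1) := by rw [hQ, mul_pow]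
    rw [hab'] at this
    rw [pow_add (-b) d, neg_pow b (m + 1)]
    have hs : (-1 : ℂ) ^ m * (-1) ^ m = 1 := by rw [← mul_pow]; norm_num
    linear_combination (-1) * ((-b) ^ d * ((qPoch Q Q (d + (m + 1) + (m + 1)))⁻¹ *
      (qPoch Q Q d)⁻¹)) * this + (-b) ^ d * b ^ (m + 1) * a ^ (m + 1) *
      Q ^ ((d + (m + 1)) ^ 2 + (d + (m + 1)).choose 2) * Q ^ (m + 1).choose 2 *
      ((qPoch Q Q d)⁻¹ * (qPoch Q Q (d + (m + 1) + (m + 1)))⁻¹) * hs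

/-- Dominated convergence: the kernels are uniformly bounded and each tends to 1/(q;q)_∞². -/
theorem tendsto_sum_baileyA {q : ℂ} (hq : ‖q‖ < 1) {c d : ℕ → ℂ} (hc : Summable c)
    (hd : Summable d) :
    Tendsto (fun N => ∑ m ∈ range (N + 1), (c m * baileyA q N m - d m * baileyA q N (m + 1)))
      atTop (𝓝 ((∑' m, (c m - d m)) * ((qPochInf q q)⁻¹ * (qPochInf q q)⁻¹))) := by
  obtain ⟨C, hC⟩ := invBounded_qPoch hq hq
  have hC0 : 0 ≤ C := (norm_nonneg _).trans (hC 0)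
  have hbd : ∀ N m, ‖baileyA q N m‖ ≤ C * C := fun N m => by
    rw [baileyA, norm_mul]
    exact mul_le_mul (norm_invPoch_le hC _ _) (hC _) (norm_nonneg _) hC0
  have hlim : ∀ m, Tendsto (fun N => baileyA q N m) atTop
      (𝓝 ((qPochInf q q)⁻¹ * (qPochInf q q)⁻¹)) := fun m =>
    (tendsto_invPoch hq m).mul (((tendsto_qPoch q hq).inv₀ (qPochInf_ne_zero hq hq)).comp
      (tendsto_add_atTop_nat m))
  have hts : ∀ N, ∑ m ∈ range (N + 1), (c m * baileyA q N m - d m * baileyA q N (m + 1)) =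
      ∑' m, (c m * baileyA q N m - d m * baileyA q N (m + 1)) := fun N =>
    (tsum_eq_sum fun m hm => by
      rw [baileyA, baileyA, invPoch_of_lt (by simpa using hm),
        invPoch_of_lt (Nat.lt_succ_of_lt (by simpa using hm))]
      ring).symm
  simp only [hts]
  rw [← tsum_mul_right]
  refine tendsto_tsum_of_dominated_convergence
    (bound := fun m => (‖c m‖ + ‖d m‖) * (C * C)) ((hc.norm.add hd.norm).mul_right _) ?_ ?_
  · intro m
    rw [sub_mul]
    exact ((hlim m).const_mul _).sub ((hlim (m + 1)).const_mul _)
  · refine Eventually.of_forall fun N m => (norm_sub_le _ _).trans ?_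
    rw [norm_mul, norm_mul, add_mul]
    exact add_le_add (mul_le_mul_of_nonneg_left (hbd _ _) (norm_nonneg _))
      (mul_le_mul_of_nonneg_left (hbd _ _) (norm_nonneg _))

theorem summable_theta_terms {b Q : ℂ} (hb : ‖b‖ < 1) (hQ : ‖Q‖ < 1) :
    Summable fun m : ℕ => (-1) ^ m * b ^ m * Q ^ m.choose 2 := by
  refine Summable.of_norm_bounded (summable_geometric_of_lt_one (norm_nonneg b) hb) fun m => ?_
  rw [norm_mul, norm_mul, norm_pow, norm_pow, norm_pow, norm_neg, norm_one, one_pow, one_mul]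
  exact mul_le_of_le_one_right (pow_nonneg (norm_nonneg b) _) (pow_le_one₀ (norm_nonneg _) hQ.le)

theorem summable_theta_terms_succ {a Q : ℂ} (ha : ‖a‖ < 1) (hQ : ‖Q‖ < 1) :
    Summable fun m : ℕ => (-1) ^ m * a ^ (m + 1) * Q ^ (m + 1).choose 2 := by
  refine (((summable_nat_add_iff 1).mpr (summable_theta_terms ha hQ)).mul_left (-1)).congr
    fun m => ?_
  ring

/-- Jacobi's triple product identity, with the bilateral sum folded. -/
theorem jacobi_triple_product {a b : ℂ} (ha : ‖a‖ < 1) (hb : ‖b‖ < 1)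
    (h0 : a = 0 ↔ b = 0) :
    ∑' m : ℕ, ((-1) ^ m * b ^ m * (a * b) ^ m.choose 2 -
      (-1) ^ m * a ^ (m + 1) * (a * b) ^ (m + 1).choose 2) = qPochInf₃ a b (a * b) (a * b) := by
  have hab : ‖a * b‖ < 1 := by
    rw [norm_mul]
    exact mul_lt_one_of_nonneg_of_lt_one_left (norm_nonneg a) ha hb.le
  by_cases ha0 : a = 0
  -- This case covers q = 0 in the application.
  · have hb0 := h0.mp ha0
    subst ha0 hb0
    rw [tsum_eq_single 0 fun m hm => by simp [hm]]
    simp [qPochInf₃, qPochInf]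
  · have hb0 : b ≠ 0 := fun h => ha0 (h0.mpr h)
    have h1 := tendsto_sum_baileyA hab (summable_theta_terms hb hab)
      (summable_theta_terms_succ ha hab)
    simp only [finite_jacobi_triple_product ha0 hb0 hab] at h1
    have hne := qPochInf_ne_zero hab hab
    have h2 := ((tendsto_qPoch a hab).mul (tendsto_qPoch b hab)).mul
      (((tendsto_qPoch (a * b) hab).inv₀ hne).comp
        (tendsto_id.const_mul_atTop' (show 0 < 2 by norm_num)))
    have h3 := tendsto_nhds_unique h1 h2
    rw [qPochInf₃]
    generalize ∑' m : ℕ, ((-1) ^ m * b ^ m * (a * b) ^ m.choose 2 -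
      (-1) ^ m * a ^ (m + 1) * (a * b) ^ (m + 1).choose 2) = T at h3 ⊢
    field_simp at h3
    rw [h3]
    ring

/-! ### The Andrews-Gordon identity as a limit. -/

/-- The Andrews-Gordon identity. -/
theorem hasSum_agTerm {q : ℂ} (hq : ‖q‖ < 1) {k i : ℕ} (hi : 1 ≤ i) (hik : i ≤ k + 1) :
    HasSum (fun n : Fin k → ℕ => agTerm q i n)
      (qPochInf₃ (q ^ i) (q ^ (2 * k + 3 - i)) (q ^ (2 * k + 3)) (q ^ (2 * k + 3)) /
        qPochInf q q) := by
  obtain ⟨C, hC⟩ := invBounded_qPoch hq hq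
  have hne := qPochInf_ne_zero hq hq
  have hQ : q ^ (2 * k + 3) = q ^ i * q ^ (2 * k + 3 - i) := by
    rw [← pow_add]; congr 1; omega
  have ha : ‖q ^ i‖ < 1 := norm_pow_lt_one hq (by omega)
  have hb : ‖q ^ (2 * k + 3 - i)‖ < 1 := norm_pow_lt_one hq (by omega)
  have hQ1 : ‖q ^ i * q ^ (2 * k + 3 - i)‖ < 1 := hQ ▸ norm_pow_lt_one hq (by omega)
  have hc : ∀ m, agAlpha q k i m = (-1) ^ m * (q ^ (2 * k + 3 - i)) ^ m *
      (q ^ i * q ^ (2 * k + 3 - i)) ^ m.choose 2 := by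
    intro m
    rw [agAlpha, ← hQ, mul_assoc, ← pow_mul, ← pow_mul, ← pow_add]
    congr 2
    have h2 := two_mul_choose_two m
    zify [hi, show i ≤ k + 2 by omega, show i ≤ 2 * k + 3 by omega]
    linear_combination (-(k : ℤ) - 1) * h2
  have hd : ∀ m, agAlpha q k i m * q ^ (i * (2 * m + 1)) = (-1) ^ m * (q ^ i) ^ (m + 1) *
      (q ^ i * q ^ (2 * k + 3 - i)) ^ (m + 1).choose 2 := by
    intro m
    rw [agAlpha, ← hQ, mul_assoc, mul_assoc, ← pow_add, ← pow_mul, ← pow_mul, ← pow_add,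
      choose_two_succ]
    congr 2
    have h2 := two_mul_choose_two m
    zify [hi, show i ≤ k + 2 by omega]
    linear_combination (-(k : ℤ) - 1) * h2
  -- Two limits of the same closed form: termwise in the multiple series it gains one factor
  -- 1/(q;q)_∞, through the theta series two. One of them cancels.
  have h1 : Tendsto (fun N => agClosed q k i N) atTop
      (𝓝 ((∑' n : Fin k → ℕ, agTerm q i n) * (qPochInf q q)⁻¹)) := by
    simp only [← fun N => (hasSum_agTerm_mul_invPoch hq hi hik N).tsum_eq]
    rw [← tsum_mul_right]
    refine tendsto_tsum_of_dominated_convergence (bound := fun n => ‖agTerm q i n‖ * C)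
      ((summable_agTerm hq k i).norm.mul_right _)
      (fun n => (tendsto_invPoch hq _).const_mul _) (Eventually.of_forall fun N n => ?_)
    rw [norm_mul]
    exact mul_le_mul_of_nonneg_left (norm_invPoch_le hC _ _) (norm_nonneg _)
  have h2 := tendsto_sum_baileyA hq (summable_theta_terms hb hQ1)
    (summable_theta_terms_succ ha hQ1)
  rw [jacobi_triple_product ha hb (by
    rw [pow_eq_zero_iff (by omega), pow_eq_zero_iff (by omega)])] at h2
  replace h2 := h2.congr (f₂ := fun N => agClosed q k i N) fun N =>
    sum_congr rfl fun m _ => by rw [← hc, ← hd]; ring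
  rw [← hQ] at h2
  have h3 := tendsto_nhds_unique h1 h2
  have h4 : ∑' n : Fin k → ℕ, agTerm q i n =
      qPochInf₃ (q ^ i) (q ^ (2 * k + 3 - i)) (q ^ (2 * k + 3)) (q ^ (2 * k + 3)) /
        qPochInf q q := by
    field_simp at h3 ⊢
    exact h3
  rw [← h4]
  exact (summable_agTerm hq k i).hasSum

/-! ### Euler's expansion of (-q^(n+1);q)_∞. -/

theorem le_choose_two_succ (m : ℕ) : m ≤ (m + 1).choose 2 := by
  rw [choose_two_succ]; exact Nat.le_add_left _ _

/-- Euler's expansion of `(-q^(n+1);q)_∞ = (-q;q)_∞ / (-q;q)_n`. -/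
theorem hasSum_euler {q : ℂ} (hq : ‖q‖ < 1) (n : ℕ) :
    HasSum (fun m : ℕ => q ^ ((m + 1).choose 2 + m * n) / qPoch q q m)
      (qPochInf (-q) q / qPoch (-q) q n) := by
  let f : ℕ → ℕ → ℂ := fun n m => q ^ ((m + 1).choose 2 + m * n) / qPoch q q m
  have hgeo := summable_geometric_of_lt_one (norm_nonneg q) hq
  have hs : ∀ n, Summable (f n) := fun n =>
    summable_pow_div hq (w := id) hgeo
      (fun m => (le_choose_two_succ m).trans (Nat.le_add_right _ _)) (invBounded_qPoch hq hq)
  -- Multiplying the term m + 1 by 1 - q^(m+1) cancels the last denominator factor; this gives F(n)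
  -- = (1 + q^(n+1)) F(n+1) for the sum F(n).
  have hrec : ∀ n, ∑' m, f n m = (1 + q ^ (n + 1)) * ∑' m, f (n + 1) m := by
    intro n
    have h0 : f n 0 = f (n + 1) 0 := by simp [f]
    have h1 : ∀ m, f n (m + 1) = f (n + 1) (m + 1) + q ^ (n + 1) * f (n + 1) m := by
      intro m
      have : 1 - q ^ (m + 1) ≠ 0 := one_sub_pow_ne_zero hq (Nat.succ_ne_zero m)
      have h2 := qPoch_ne_zero hq hq m
      simp only [f, qPoch_self_succ]
      rw [div_add' _ _ _ (mul_ne_zero h2 this), choose_two_succ (m + 1)]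
      congr 1
      field_simp
      ring
    rw [(hs n).tsum_eq_zero_add, h0, tsum_congr h1,
      ((summable_nat_add_iff 1).mpr (hs (n + 1))).tsum_add ((hs (n + 1)).mul_left _),
      tsum_mul_left, ← add_assoc, ← (hs (n + 1)).tsum_eq_zero_add]
    ring
  have hind : ∀ n, ∑' m, f 0 m = qPoch (-q) q n * ∑' m, f n m := by
    intro n
    induction n with
    | zero => simp [qPoch_zero]
    | succ n ih => rw [ih, hrec, qPoch_succ]; ring
  -- Only the term m = 0 survives as n grows; with the iterated recursion this determines F(0).
  have hlim : Tendsto (fun n => ∑' m, f n m) atTop (𝓝 1) := by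
    obtain ⟨C, hC⟩ := invBounded_qPoch hq hq
    rw [← tsum_ite_eq (0 : ℕ) (fun _ => (1 : ℂ))]
    refine tendsto_tsum_of_dominated_convergence (bound := fun m => ‖q‖ ^ m * C)
      (hgeo.mul_right C) (fun m => ?_) (Eventually.of_forall fun n m => ?_)
    · split_ifs with hm
      · subst hm; simp [f, qPoch_zero]
      · have h := (tendsto_pow_atTop_nhds_zero_of_norm_lt_one (norm_pow_lt_one hq hm)).const_mul
          (q ^ (m + 1).choose 2 / qPoch q q m)
        rw [mul_zero] at h
        refine h.congr fun n => ?_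
        simp only [f, pow_add, pow_mul]
        ring
    · simp only [f]
      rw [div_eq_mul_inv, norm_mul, norm_pow]
      exact mul_le_mul (pow_le_pow_of_le_one (norm_nonneg q) hq.le
        ((le_choose_two_succ m).trans (Nat.le_add_right _ _))) (hC m) (norm_nonneg _)
        (pow_nonneg (norm_nonneg q) _)
  have h0 : ∑' m, f 0 m = qPochInf (-q) q := by
    have h := (tendsto_qPoch (-q) hq).mul hlim
    simp only [← hind, mul_one] at h
    exact tendsto_nhds_unique tendsto_const_nhds h
  have hne := qPoch_ne_zero (a := -q) (by rwa [norm_neg]) hq n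
  have hn : ∑' m, f n m = qPochInf (-q) q / qPoch (-q) q n := by
    rw [eq_div_iff hne, mul_comm, ← hind, h0]
  rw [← hn]
  exact (hs n).hasSum

theorem qPoch_mul_qPoch_neg (q : ℂ) (n : ℕ) :
    qPoch q q n * qPoch (-q) q n = qPoch (q ^ 2) (q ^ 2) n := by
  rw [qPoch, qPoch, qPoch, ← prod_mul_distrib]
  exact prod_congr rfl fun j _ => by ring

theorem qPochInf_mul_qPochInf_neg {q : ℂ} (hq : ‖q‖ < 1) :
    qPochInf q q * qPochInf (-q) q = qPochInf (q ^ 2) (q ^ 2) := by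
  have h := (tendsto_qPoch q hq).mul (tendsto_qPoch (-q) hq)
  simp only [qPoch_mul_qPoch_neg] at h
  exact tendsto_nhds_unique h (tendsto_qPoch _ (norm_pow_lt_one hq two_ne_zero))

/-! ### Power series identities from q-difference equations. -/

open PowerSeries in
/-- A first order `p`-difference equation determines a power series up to its constant term. -/
theorem PowerSeries.eq_of_mul_eq_mul_rescale {p : ℂ} (hp : ‖p‖ < 1) {R P F G : ℂ⟦X⟧}
    (hR : constantCoeff R = 1) (hP : constantCoeff P = 1)
    (hF : R * F = P * rescale p F) (hG : R * G = P * rescale p G)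
    (h0 : constantCoeff F = constantCoeff G) : F = G := by
  have hD : R * (F - G) = P * rescale p (F - G) := by rw [map_sub, mul_sub, mul_sub, hF, hG]
  -- If all lower coefficients of F - G vanish, comparing the coefficients of X^n leaves (1 - p^n)
  -- times the n-th one equal to 0.
  have key : ∀ n, coeff n (F - G) = 0 := by
    intro n
    induction n using Nat.strong_induction_on with
    | _ n ih =>
      rcases Nat.eq_zero_or_pos n with rfl | hn
      · simpa [sub_eq_zero] using h0
      have h := congrArg (coeff n) hD
      rw [coeff_mul, coeff_mul, sum_eq_single (0, n), sum_eq_single (0, n)] at h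
      · simp only [coeff_zero_eq_constantCoeff, hR, hP, coeff_rescale, one_mul] at h
        have h2 : (1 - p ^ n) * coeff n (F - G) = 0 := by rw [sub_mul, one_mul, ← h, sub_self]
        exact (mul_eq_zero.mp h2).resolve_left (one_sub_pow_ne_zero hp hn.ne')
      · rintro ⟨a, b⟩ hx hne
        have hx : a + b = n := by simpa using hx
        have : b ≠ n := fun hb => hne (by ext <;> simp <;> omega)
        rw [coeff_rescale, ih b (by omega)]
        simp
      · intro hx; simp at hx
      · rintro ⟨a, b⟩ hx hne
        have hx : a + b = n := by simpa using hx
        have : b ≠ n := fun hb => hne (by ext <;> simp <;> omega)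
        rw [ih b (by omega), mul_zero]
      · intro hx; simp at hx
  exact sub_eq_zero.mp (PowerSeries.ext key)

open PowerSeries

/-- The series `∑ q^(n(n-1)/2) X^n / (q;q)_n`, which expands `(-X;q)_∞`. -/
noncomputable def eulerSeries (q : ℂ) : ℂ⟦X⟧ := mk fun n => q ^ n.choose 2 / qPoch q q n

/-- The series `∑ X^n / (q;q)_n`, which expands `1 / (X;q)_∞`. -/
noncomputable def invEulerSeries (q : ℂ) : ℂ⟦X⟧ := mk fun n => (qPoch q q n)⁻¹

/-- The series `∑ X^(2n) / (q²;q²)_n`, which expands `1 / (X²;q²)_∞`. -/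
noncomputable def invEulerSeriesSq (q : ℂ) : ℂ⟦X⟧ :=
  mk fun n => if Even n then (qPoch (q ^ 2) (q ^ 2) (n / 2))⁻¹ else 0

theorem constantCoeff_eulerSeries (q : ℂ) : constantCoeff (eulerSeries q) = 1 := by
  simp [eulerSeries, qPoch_zero]

theorem constantCoeff_invEulerSeries (q : ℂ) : constantCoeff (invEulerSeries q) = 1 := by
  simp [invEulerSeries, qPoch_zero]

theorem constantCoeff_invEulerSeriesSq (q : ℂ) : constantCoeff (invEulerSeriesSq q) = 1 := by
  simp [invEulerSeriesSq, qPoch_zero]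

theorem eulerSeries_eq {q : ℂ} (hq : ‖q‖ < 1) :
    eulerSeries q = (1 + X) * rescale q (eulerSeries q) := by
  ext n
  rw [add_mul, one_mul, map_add]
  cases n with
  | zero => simp [eulerSeries, qPoch_zero]
  | succ n =>
    rw [coeff_succ_X_mul, coeff_rescale, coeff_rescale, eulerSeries, coeff_mk, coeff_mk,
      div_eq_mul_inv, div_eq_mul_inv, ← inv_qPoch_self_succ hq n, choose_two_succ]
    ring

theorem invEulerSeries_eq {q : ℂ} (hq : ‖q‖ < 1) :
    (1 - X) * invEulerSeries q = rescale q (invEulerSeries q) := by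
  ext n
  rw [sub_mul, one_mul, map_sub]
  cases n with
  | zero => simp [invEulerSeries, qPoch_zero]
  | succ n =>
    rw [coeff_succ_X_mul, coeff_rescale, invEulerSeries, coeff_mk, coeff_mk,
      ← inv_qPoch_self_succ hq n]
    ring

theorem invEulerSeriesSq_eq {q : ℂ} (hq : ‖q‖ < 1) :
    (1 - X ^ 2) * invEulerSeriesSq q = rescale q (invEulerSeriesSq q) := by
  ext n
  rw [sub_mul, one_mul, map_sub, coeff_rescale, coeff_X_pow_mul']
  match n with
  | 0 => simp
  | 1 => simp [invEulerSeriesSq]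
  | n + 2 =>
    rw [if_pos (by omega), Nat.add_sub_cancel, invEulerSeriesSq, coeff_mk, coeff_mk]
    simp only [Nat.even_add_one, not_not]
    split_ifs with h
    · obtain ⟨d, rfl⟩ := h
      rw [show (d + d + 2) / 2 = d + 1 by omega, show (d + d) / 2 = d by omega,
        ← inv_qPoch_self_succ (norm_pow_lt_one hq two_ne_zero) d]
      ring
    · ring

/-- Both sides solve (1 - X²) F(X) = (1 + X) F(qX) with constant term 1. -/
theorem eulerSeries_mul_invEulerSeriesSq {q : ℂ} (hq : ‖q‖ < 1) :
    eulerSeries q * invEulerSeriesSq q = invEulerSeries q := by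
  refine eq_of_mul_eq_mul_rescale (R := 1 - X ^ 2) (P := 1 + X) hq (by simp) (by simp) ?_ ?_ ?_
  · rw [map_mul, ← invEulerSeriesSq_eq hq]
    conv_lhs => rw [eulerSeries_eq hq]
    ring
  · rw [← invEulerSeries_eq hq]
    ring
  · rw [map_mul, constantCoeff_eulerSeries, constantCoeff_invEulerSeriesSq,
      constantCoeff_invEulerSeries, one_mul]

/-- The factors of (-X;q)_∞ are sorted by the parity of the power of q. Both sides solve F(X) = (1 +
X)(1 + qX) F(q²X). -/
theorem eulerSeries_sq_mul_rescale {q : ℂ} (hq : ‖q‖ < 1) :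
    eulerSeries (q ^ 2) * rescale q (eulerSeries (q ^ 2)) = eulerSeries q := by
  have hq2 := norm_pow_lt_one hq two_ne_zero
  refine eq_of_mul_eq_mul_rescale (R := 1) (P := (1 + X) * rescale q (1 + X)) hq2
    (by simp) (by simp) ?_ ?_ ?_
  · rw [map_mul, one_mul]
    conv_lhs => rw [eulerSeries_eq hq2]
    rw [map_mul, rescale_rescale, rescale_rescale, mul_comm q]
    ring
  · conv_lhs => rw [eulerSeries_eq hq]
    conv_lhs => rw [eulerSeries_eq hq]
    rw [map_mul, rescale_rescale, ← sq]
    ring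
  · rw [map_mul, constantCoeff_eulerSeries, constantCoeff_eulerSeries, one_mul,
      ← coeff_zero_eq_constantCoeff_apply, coeff_rescale, coeff_zero_eq_constantCoeff_apply,
      constantCoeff_eulerSeries, pow_zero, one_mul]

/-! ### Summing out and merging variables. -/

/-- Summation of an absolutely convergent series over its first variable. -/
theorem hasSum_of_fiber_fst {α β : Type*} {f : α × β → ℂ} {g : β → ℂ} {s : ℂ} (hf : Summable f)
    (h : ∀ b, HasSum (fun a => f (a, b)) (g b)) (hg : Summable g → HasSum g s) :
    HasSum f s := by
  have h1 : Summable (f ∘ Prod.swap) := (Equiv.prodComm β α).summable_iff.mpr hf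
  have h2 : HasSum g (∑' p, (f ∘ Prod.swap) p) := h1.hasSum.prod_fiberwise h
  -- Summability of `g` is a by-product, so `hg` may assume it; in a chain of reductions only the
  -- full series needs an estimate.
  rw [(hg h2.summable).unique h2]
  exact (Equiv.prodComm β α).hasSum_iff.mp h1.hasSum

/-- Summation of an absolutely convergent series over the diagonals of the first two variables. -/
theorem hasSum_of_antidiagonal {β : Type*} {f : ℕ × ℕ × β → ℂ} {g : ℕ × β → ℂ} {s : ℂ}
    (hf : Summable f) (h : ∀ n t, ∑ x ∈ antidiagonal n, f (x.1, x.2, t) = g (n, t))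
    (hg : Summable g → HasSum g s) : HasSum f s := by
  have h1 := hf.hasSum.tsum_fiberwise fun x => (x.1 + x.2.1, x.2.2)
  have h2 : ∀ c : ℕ × β, ∑' x : (fun x : ℕ × ℕ × β => (x.1 + x.2.1, x.2.2)) ⁻¹' {c}, f x =
      g c := by
    rintro ⟨n, t⟩
    let ψ : ℕ × ℕ ↪ ℕ × ℕ × β := ⟨fun x => (x.1, x.2, t), fun x y hxy => by
      simpa [Prod.ext_iff] using hxy⟩
    have hset : (fun x : ℕ × ℕ × β => (x.1 + x.2.1, x.2.2)) ⁻¹' {(n, t)} =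
        ↑((antidiagonal n).map ψ) := by
      ext ⟨a, b, u⟩
      simp only [Set.mem_preimage, Set.mem_singleton_iff, coe_map, Set.mem_image, mem_coe,
        HasAntidiagonal.mem_antidiagonal, Prod.mk.injEq]
      constructor
      · rintro ⟨rfl, rfl⟩
        exact ⟨(a, b), rfl, rfl⟩
      · rintro ⟨x, hx, hxe⟩
        cases hxe
        exact ⟨hx, rfl⟩
    rw [hset, Finset.tsum_subtype', sum_map, ← h]
    rfl
  simp only [h2] at h1
  rw [(hg h1.summable).unique h1]
  exact hf.hasSum

/-- Merging the two variables of the convolution of `eulerSeries` and `invEulerSeriesSq`. -/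
theorem hasSum_of_add_two_mul {β : Type*} {q : ℂ} (hq : ‖q‖ < 1) {f : ℕ × ℕ × β → ℂ}
    {K : ℕ → β → ℂ} {s : ℂ} (hf : Summable f)
    (h : ∀ a b t, f (a, b, t) =
      q ^ a.choose 2 / qPoch q q a * (qPoch (q ^ 2) (q ^ 2) b)⁻¹ * K (a + 2 * b) t)
    (hg : HasSum (fun x : ℕ × β => (qPoch q q x.1)⁻¹ * K x.1 x.2) s) : HasSum f s := by
  -- Replacing b by c = 2b, with value 0 at odd c, turns a + 2b into a + c and makes the sum an
  -- ordinary convolution.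
  let φ : ℕ × ℕ × β → ℕ × ℕ × β := fun x => (x.1, 2 * x.2.1, x.2.2)
  have hφ : Function.Injective φ := by
    rintro ⟨a, b, t⟩ ⟨a', b', t'⟩ hx
    simpa [φ] using hx
  let F : ℕ × ℕ × β → ℂ := fun x => if Even x.2.1 then f (x.1, x.2.1 / 2, x.2.2) else 0
  have hF : ∀ x ∉ Set.range φ, F x = 0 := by
    rintro ⟨a, c, t⟩ hx
    refine if_neg fun hc => hx ?_
    obtain ⟨b, rfl⟩ := hc.two_dvd
    exact ⟨(a, b, t), rfl⟩
  have hcomp : F ∘ φ = f := by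
    ext ⟨a, b, t⟩
    simp [F, φ]
  rw [← hcomp, hφ.hasSum_iff hF]
  refine hasSum_of_antidiagonal (by rwa [← hφ.summable_iff hF, hcomp]) (fun n t => ?_)
    fun _ => hg
  have h1 := congrArg (coeff n) (eulerSeries_mul_invEulerSeriesSq hq)
  rw [coeff_mul, invEulerSeries, coeff_mk] at h1
  rw [← h1, sum_mul]
  refine sum_congr rfl fun x hx => ?_
  simp only [F, eulerSeries, invEulerSeriesSq, coeff_mk]
  split_ifs with hc
  · rw [h, Nat.two_mul_div_two_of_even hc, HasAntidiagonal.mem_antidiagonal.mp hx]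
  · ring

/-- Merging the two variables of the convolution of two series `eulerSeries (q ^ 2)`. -/
theorem hasSum_of_add {β : Type*} {q : ℂ} (hq : ‖q‖ < 1) {f : ℕ × ℕ × β → ℂ}
    {K : ℕ → β → ℂ} {s : ℂ} (hf : Summable f)
    (h : ∀ a b t, f (a, b, t) = (q ^ 2) ^ a.choose 2 / qPoch (q ^ 2) (q ^ 2) a *
      (q ^ b * ((q ^ 2) ^ b.choose 2 / qPoch (q ^ 2) (q ^ 2) b)) * K (a + b) t)
    (hg : HasSum (fun x : ℕ × β => q ^ x.1.choose 2 / qPoch q q x.1 * K x.1 x.2) s) :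
    HasSum f s := by
  refine hasSum_of_antidiagonal hf (fun n t => ?_) fun _ => hg
  have h1 := congrArg (coeff n) (eulerSeries_sq_mul_rescale hq)
  simp only [coeff_mul, coeff_rescale] at h1
  simp only [eulerSeries, coeff_mk] at h1
  rw [← h1, sum_mul]
  exact sum_congr rfl fun x hx => by rw [h, HasAntidiagonal.mem_antidiagonal.mp hx]

theorem hasSum_of_add' {β : Type*} {q : ℂ} (hq : ‖q‖ < 1) {f : ℕ × ℕ × β → ℂ}
    {K : ℕ → β → ℂ} {s : ℂ} (hf : Summable f)
    (h : ∀ a b t, f (a, b, t) = q ^ a * ((q ^ 2) ^ a.choose 2 / qPoch (q ^ 2) (q ^ 2) a) *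
      ((q ^ 2) ^ b.choose 2 / qPoch (q ^ 2) (q ^ 2) b) * K (a + b) t)
    (hg : HasSum (fun x : ℕ × β => q ^ x.1.choose 2 / qPoch q q x.1 * K x.1 x.2) s) :
    HasSum f s := by
  let e : ℕ × ℕ × β ≃ ℕ × ℕ × β :=
    ⟨fun x => (x.2.1, x.1, x.2.2), fun x => (x.2.1, x.1, x.2.2), fun _ => rfl, fun _ => rfl⟩
  rw [← e.hasSum_iff]
  refine hasSum_of_add hq (e.summable_iff.mpr hf) (fun a b t => (h b a t).trans ?_) hg
  rw [add_comm b a]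
  ring

/-! ### Andrews-Gordon with one variable singled out, in bases q, q² and q⁴. -/

/-- The triple product on the right of the Andrews-Gordon identity of modulus `2k + 3`. -/
noncomputable def agProduct (q : ℂ) (k i : ℕ) : ℂ :=
  qPochInf₃ (q ^ i) (q ^ (2 * k + 3 - i)) (q ^ (2 * k + 3)) (q ^ (2 * k + 3))

theorem agProduct_pow_two (q : ℂ) (k i : ℕ) :
    agProduct (q ^ 2) k i = qPochInf₃ (q ^ (2 * i)) (q ^ (4 * k + 6 - 2 * i)) (q ^ (4 * k + 6))
      (q ^ (4 * k + 6)) := by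
  rw [agProduct, ← pow_mul, ← pow_mul, ← pow_mul, show 2 * (2 * k + 3) = 4 * k + 6 by ring,
    show 2 * (2 * k + 3 - i) = 4 * k + 6 - 2 * i by omega]

theorem agProduct_pow_four (q : ℂ) (k i : ℕ) :
    agProduct (q ^ 4) k i = qPochInf₃ (q ^ (4 * i)) (q ^ (8 * k + 12 - 4 * i))
      (q ^ (8 * k + 12)) (q ^ (8 * k + 12)) := by
  rw [agProduct, ← pow_mul, ← pow_mul, ← pow_mul, show 4 * (2 * k + 3) = 8 * k + 12 by ring,
    show 4 * (2 * k + 3 - i) = 8 * k + 12 - 4 * i by omega]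

theorem hasSum_ag_cons {q : ℂ} (hq : ‖q‖ < 1) {r i : ℕ} (hi : 1 ≤ i) (hir : i ≤ r + 2) :
    HasSum (fun x : ℕ × (Fin r → ℕ) => (qPoch q q x.1)⁻¹ *
      (q ^ agExponent i (consVec x.1 x.2) * (∏ l, qPoch q q (x.2 l))⁻¹))
      (agProduct q (r + 1) i / qPochInf q q) := by
  have h := (Fin.consEquiv fun _ : Fin (r + 1) => ℕ).hasSum_iff.mpr (hasSum_agTerm hq hi hir)
  refine h.congr_fun fun x => ?_
  simp only [Function.comp, Fin.consEquiv, Equiv.coe_fn_mk, agTerm, Fin.prod_univ_succ,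
    Fin.cons_zero, Fin.cons_succ, consVec, div_eq_mul_inv, mul_inv]
  ring

theorem hasSum_ag_snoc {q : ℂ} (hq : ‖q‖ < 1) {r i : ℕ} (hi : 1 ≤ i) (hir : i ≤ r + 2) :
    HasSum (fun x : ℕ × (Fin r → ℕ) => (qPoch q q x.1)⁻¹ *
      (q ^ agExponent i (snocVec x.2 x.1) * (∏ l, qPoch q q (x.2 l))⁻¹))
      (agProduct q (r + 1) i / qPochInf q q) := by
  have h := (Fin.snocEquiv fun _ : Fin (r + 1) => ℕ).hasSum_iff.mpr (hasSum_agTerm hq hi hir)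
  refine h.congr_fun fun x => ?_
  simp only [Function.comp, Fin.snocEquiv, Equiv.coe_fn_mk, agTerm, Fin.prod_univ_castSucc,
    Fin.snoc_last, Fin.snoc_castSucc, snocVec, div_eq_mul_inv, mul_inv]
  ring

theorem sum_le_agExponent_cons {r : ℕ} (i a : ℕ) (t : Fin r → ℕ) :
    a + ∑ l, t l ≤ agExponent i (consVec a t) := by
  rw [← partialN_cons_one, partialN_one]
  exact sum_le_agExponent i _

theorem sum_le_agExponent_snoc {r : ℕ} (i a : ℕ) (t : Fin r → ℕ) :
    a + ∑ l, t l ≤ agExponent i (snocVec t a) := by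
  refine le_trans (le_of_eq ?_) (sum_le_agExponent i _)
  simp [snocVec, Fin.sum_univ_castSucc, add_comm]

/-- This keeps the exponents natural, and the series dominated, when a binomial coefficient is
subtracted. -/
theorem choose_two_add_le_agExponent_cons {r : ℕ} (i a : ℕ) (t : Fin r → ℕ) :
    a.choose 2 + (a + ∑ l, t l) ≤ agExponent i (consVec a t) := by
  refine le_trans ?_ (sq_sum_le_agExponent i (consVec a t))
  rw [← partialN_one (consVec a t), partialN_cons_one]
  have h := two_mul_choose_two a
  generalize ∑ l, t l = S
  zify
  nlinarith [mul_nonneg (Int.natCast_nonneg a) (Int.natCast_nonneg S),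
    Int.natCast_nonneg (a.choose 2), Int.le_self_sq (S : ℤ)]

/-- Division by `(-q;q)_n` turns `(q;q)_n` into `(q²;q²)_n`. -/
theorem div_qPoch_neg_mul (q P A B : ℂ) (n : ℕ) :
    P / qPoch (-q) q n * (A / (qPoch q q n * B)) =
      P * ((qPoch (q ^ 2) (q ^ 2) n)⁻¹ * (A * B⁻¹)) := by
  rw [← qPoch_mul_qPoch_neg]
  simp only [div_eq_mul_inv, mul_inv]
  ring

theorem qPochInf_neg_mul_div {q : ℂ} (hq : ‖q‖ < 1) (R : ℂ) :
    qPochInf (-q) q * (R / qPochInf (q ^ 2) (q ^ 2)) = R / qPochInf q q := by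
  have h1 := qPochInf_ne_zero hq hq
  have h2 := qPochInf_ne_zero (a := -q) (by rwa [norm_neg]) hq
  rw [← qPochInf_mul_qPochInf_neg hq]
  field_simp

/-- The series left after Euler's expansion has removed m; it is the Andrews-Gordon series in base
q². -/
theorem hasSum_core_cons {q : ℂ} (hq : ‖q‖ < 1) {r i : ℕ} (hi : 1 ≤ i) (hir : i ≤ r + 2) :
    HasSum (fun x : ℕ × (Fin r → ℕ) => qPochInf (-q) q / qPoch (-q) q x.1 *
      (q ^ (2 * agExponent i (consVec x.1 x.2)) /
        (qPoch q q x.1 * ∏ l, qPoch (q ^ 2) (q ^ 2) (x.2 l))))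
      (agProduct (q ^ 2) (r + 1) i / qPochInf q q) := by
  rw [← qPochInf_neg_mul_div hq]
  refine ((hasSum_ag_cons (norm_pow_lt_one hq two_ne_zero) hi hir).mul_left _).congr_fun
    fun x => ?_
  rw [div_qPoch_neg_mul, pow_mul]

theorem hasSum_core_snoc {q : ℂ} (hq : ‖q‖ < 1) {r i : ℕ} (hi : 1 ≤ i) (hir : i ≤ r + 2) :
    HasSum (fun x : ℕ × (Fin r → ℕ) => qPochInf (-q) q / qPoch (-q) q x.1 *
      (q ^ (2 * agExponent i (snocVec x.2 x.1)) /
        (qPoch q q x.1 * ∏ l, qPoch (q ^ 2) (q ^ 2) (x.2 l))))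
      (agProduct (q ^ 2) (r + 1) i / qPochInf q q) := by
  rw [← qPochInf_neg_mul_div hq]
  refine ((hasSum_ag_snoc (norm_pow_lt_one hq two_ne_zero) hi hir).mul_left _).congr_fun
    fun x => ?_
  rw [div_qPoch_neg_mul, pow_mul]

theorem summable_weight {r : ℝ} (h0 : 0 ≤ r) (h1 : r < 1) (k : ℕ) :
    Summable fun x : ℕ × (Fin k → ℕ) => r ^ (x.1 + ∑ l, x.2 l) :=
  summable_pow_add (u := fun n => n) h0 (summable_geometric_of_lt_one h0 h1)
    (summable_pow_sum_pi h0 h1 k)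

theorem summable_weight_cons {β : Type*} {r : ℝ} (h0 : 0 ≤ r) (h1 : r < 1) {w : β → ℕ}
    (hw : Summable fun y => r ^ w y) : Summable fun x : ℕ × β => r ^ (x.1 + w x.2) :=
  summable_pow_add (u := fun n => n) h0 (summable_geometric_of_lt_one h0 h1) hw

/-! ### The ten series. -/

section series

variable {q : ℂ} {r i : ℕ}

theorem hasSum_euler_ag_cons (hq : ‖q‖ < 1) (hi : 1 ≤ i) (hir : i ≤ r + 2) :
    HasSum (fun ((m, n₁, t) : ℕ × ℕ × (Fin r → ℕ)) =>
        q ^ ((m + 1).choose 2 + m * n₁ + 2 * agExponent i (consVec n₁ t)) /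
          (qPoch q q m * qPoch q q n₁ * ∏ l, qPoch (q ^ 2) (q ^ 2) (t l)))
      (agProduct (q ^ 2) (r + 1) i / qPochInf q q) := by
  have hq2 := norm_pow_lt_one hq two_ne_zero
  have hb := invBounded_qPoch hq hq
  have hb2 := invBounded_qPoch hq2 hq2
  refine hasSum_of_fiber_fst ?_ (fun x => ?_) fun _ => hasSum_core_cons hq hi hir
  · refine summable_of_eq_pow_div hq (summable_weight_cons (norm_nonneg q) hq
      (summable_weight (norm_nonneg q) hq r))
      (((hb.comp fun x : ℕ × ℕ × (Fin r → ℕ) => x.1).mul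
        (hb.comp fun x : ℕ × ℕ × (Fin r → ℕ) => x.2.1)).mul
        (hb2.prod_pi.comp fun x : ℕ × ℕ × (Fin r → ℕ) => x.2.2)) ?_
    rintro ⟨m, n, t⟩
    refine ⟨_, ?_, rfl⟩
    have h1 := le_choose_two_succ m
    have h2 := sum_le_agExponent_cons i n t
    dsimp only
    omega
  · obtain ⟨n, t⟩ := x
    refine ((hasSum_euler hq n).mul_right _).congr_fun fun m => ?_
    simp only [pow_add, div_eq_mul_inv, mul_inv]
    ring

theorem hasSum_euler_ag_snoc (hq : ‖q‖ < 1) (hi : 1 ≤ i) (hir : i ≤ r + 2) :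
    HasSum (fun ((m, t, nk) : ℕ × (Fin r → ℕ) × ℕ) =>
        q ^ ((m + 1).choose 2 + m * nk + 2 * agExponent i (snocVec t nk)) /
          (qPoch q q m * (∏ l, qPoch (q ^ 2) (q ^ 2) (t l)) * qPoch q q nk))
      (agProduct (q ^ 2) (r + 1) i / qPochInf q q) := by
  have hq2 := norm_pow_lt_one hq two_ne_zero
  have hb := invBounded_qPoch hq hq
  have hb2 := invBounded_qPoch hq2 hq2
  refine hasSum_of_fiber_fst ?_ (fun x => ?_)
    fun _ => (Equiv.prodComm _ _).hasSum_iff.mpr (hasSum_core_snoc hq hi hir)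
  · refine summable_of_eq_pow_div hq (summable_weight_cons (norm_nonneg q) hq
      ((Equiv.prodComm _ _).summable_iff.mpr (summable_weight (norm_nonneg q) hq r)))
      (((hb.comp fun x : ℕ × (Fin r → ℕ) × ℕ => x.1).mul
        (hb2.prod_pi.comp fun x : ℕ × (Fin r → ℕ) × ℕ => x.2.1)).mul
        (hb.comp fun x : ℕ × (Fin r → ℕ) × ℕ => x.2.2)) ?_
    rintro ⟨m, t, n⟩
    refine ⟨_, ?_, rfl⟩
    have h1 := le_choose_two_succ m
    have h2 := sum_le_agExponent_snoc i n t
    simp only [Equiv.prodComm_apply, Prod.swap_prod_mk]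
    omega
  · obtain ⟨t, n⟩ := x
    refine ((hasSum_euler hq n).mul_right _).congr_fun fun m => ?_
    simp only [Equiv.prodComm_apply, Prod.fst_swap, Prod.snd_swap, pow_add,
      div_eq_mul_inv, mul_inv]
    ring

theorem hasSum_mul_core_sq_cons (hq : ‖q‖ < 1) (hi : 1 ≤ i) (hir : i ≤ r + 2) :
    HasSum (fun x : ℕ × (Fin r → ℕ) => qPochInf (-q) q *
      (qPochInf (-q ^ 2) (q ^ 2) / qPoch (-q ^ 2) (q ^ 2) x.1 *
      (q ^ (4 * agExponent i (consVec x.1 x.2)) /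
        (qPoch (q ^ 2) (q ^ 2) x.1 * ∏ l, qPoch (q ^ 4) (q ^ 4) (x.2 l)))))
      (agProduct (q ^ 4) (r + 1) i / qPochInf q q) := by
  rw [← qPochInf_neg_mul_div hq]
  have h := (hasSum_core_cons (norm_pow_lt_one hq two_ne_zero) hi hir).mul_left (qPochInf (-q) q)
  simp only [← pow_mul, ← mul_assoc, show 2 * 2 = 4 from rfl] at h ⊢
  exact h

/-- Summing over m₁ turns (q;q)_{m₂} into (q²;q²)_{m₂}. The sum over m₂ is then Euler's in base q²
and turns (q²;q²)_{n₁} into (q⁴;q⁴)_{n₁}. -/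
theorem hasSum_euler_euler_ag_cons (hq : ‖q‖ < 1) (hi : 1 ≤ i) (hir : i ≤ r + 2) :
    HasSum (fun ((m₁, m₂, n₁, t) : ℕ × ℕ × ℕ × (Fin r → ℕ)) =>
        q ^ ((m₁ + 1).choose 2 + m₁ * m₂ + 2 * (m₂ + 1).choose 2 + 2 * m₂ * n₁ +
            4 * agExponent i (consVec n₁ t)) /
          (qPoch q q m₁ * qPoch q q m₂ * qPoch (q ^ 2) (q ^ 2) n₁ *
            ∏ l, qPoch (q ^ 4) (q ^ 4) (t l)))
      (agProduct (q ^ 4) (r + 1) i / qPochInf q q) := by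
  have hq2 := norm_pow_lt_one hq two_ne_zero
  have hq4 := norm_pow_lt_one hq four_ne_zero
  have hb := invBounded_qPoch hq hq
  have hb2 := invBounded_qPoch hq2 hq2
  have hb4 := invBounded_qPoch hq4 hq4
  refine hasSum_of_fiber_fst (g := fun x => qPochInf (-q) q / qPoch (-q) q x.1 *
    (q ^ (2 * (x.1 + 1).choose 2 + 2 * x.1 * x.2.1 + 4 * agExponent i (consVec x.2.1 x.2.2)) /
      (qPoch q q x.1 * (qPoch (q ^ 2) (q ^ 2) x.2.1 * ∏ l, qPoch (q ^ 4) (q ^ 4) (x.2.2 l)))))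
    ?_ (fun x => ?_) fun hs =>
      hasSum_of_fiber_fst hs (fun x => ?_) fun _ => hasSum_mul_core_sq_cons hq hi hir
  · refine summable_of_eq_pow_div hq (summable_weight_cons (norm_nonneg q) hq
      (summable_weight_cons (norm_nonneg q) hq (summable_weight (norm_nonneg q) hq r)))
      ((((hb.comp fun x : ℕ × ℕ × ℕ × (Fin r → ℕ) => x.1).mul
        (hb.comp fun x : ℕ × ℕ × ℕ × (Fin r → ℕ) => x.2.1)).mul
        (hb2.comp fun x : ℕ × ℕ × ℕ × (Fin r → ℕ) => x.2.2.1)).mul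
        (hb4.prod_pi.comp fun x : ℕ × ℕ × ℕ × (Fin r → ℕ) => x.2.2.2)) ?_
    rintro ⟨m, m', n, t⟩
    refine ⟨_, ?_, rfl⟩
    have h1 := le_choose_two_succ m
    have h2 := le_choose_two_succ m'
    have h3 := sum_le_agExponent_cons i n t
    dsimp only
    omega
  · obtain ⟨m2, n, t⟩ := x
    refine ((hasSum_euler hq m2).mul_right _).congr_fun fun m => ?_
    simp only [pow_add, div_eq_mul_inv, mul_inv]
    ring
  · obtain ⟨n, t⟩ := x
    refine (((hasSum_euler hq2 n).mul_right _).mul_left _).congr_fun fun m => ?_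
    simp only [div_qPoch_neg_mul]
    simp only [pow_add, pow_mul, div_eq_mul_inv, mul_inv]
    ring

/-- Both Euler sums act on n₁, in bases q and q², and take (q;q)_{n₁} through (q²;q²)_{n₁} to
(q⁴;q⁴)_{n₁}. -/
theorem hasSum_two_euler_ag_cons (hq : ‖q‖ < 1) (hi : 1 ≤ i) (hir : i ≤ r + 2) :
    HasSum (fun ((m₁, m₂, n₁, t) : ℕ × ℕ × ℕ × (Fin r → ℕ)) =>
        q ^ ((m₁ + 1).choose 2 + m₁ * n₁ + 2 * (m₂ + 1).choose 2 + 2 * m₂ * n₁ +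
            4 * agExponent i (consVec n₁ t)) /
          (qPoch q q m₁ * qPoch (q ^ 2) (q ^ 2) m₂ * qPoch q q n₁ *
            ∏ l, qPoch (q ^ 4) (q ^ 4) (t l)))
      (agProduct (q ^ 4) (r + 1) i / qPochInf q q) := by
  have hq2 := norm_pow_lt_one hq two_ne_zero
  have hq4 := norm_pow_lt_one hq four_ne_zero
  have hb := invBounded_qPoch hq hq
  have hb2 := invBounded_qPoch hq2 hq2
  have hb4 := invBounded_qPoch hq4 hq4
  refine hasSum_of_fiber_fst (g := fun x => qPochInf (-q) q / qPoch (-q) q x.2.1 *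
    (q ^ (2 * (x.1 + 1).choose 2 + 2 * x.1 * x.2.1 + 4 * agExponent i (consVec x.2.1 x.2.2)) /
      (qPoch q q x.2.1 * (qPoch (q ^ 2) (q ^ 2) x.1 * ∏ l, qPoch (q ^ 4) (q ^ 4) (x.2.2 l)))))
    ?_ (fun x => ?_) fun hs =>
      hasSum_of_fiber_fst hs (fun x => ?_) fun _ => hasSum_mul_core_sq_cons hq hi hir
  · refine summable_of_eq_pow_div hq (summable_weight_cons (norm_nonneg q) hq
      (summable_weight_cons (norm_nonneg q) hq (summable_weight (norm_nonneg q) hq r)))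
      ((((hb.comp fun x : ℕ × ℕ × ℕ × (Fin r → ℕ) => x.1).mul
        (hb2.comp fun x : ℕ × ℕ × ℕ × (Fin r → ℕ) => x.2.1)).mul
        (hb.comp fun x : ℕ × ℕ × ℕ × (Fin r → ℕ) => x.2.2.1)).mul
        (hb4.prod_pi.comp fun x : ℕ × ℕ × ℕ × (Fin r → ℕ) => x.2.2.2)) ?_
    rintro ⟨m, m', n, t⟩
    refine ⟨_, ?_, rfl⟩
    have h1 := le_choose_two_succ m
    have h2 := le_choose_two_succ m'
    have h3 := sum_le_agExponent_cons i n t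
    dsimp only
    omega
  · obtain ⟨m2, n, t⟩ := x
    refine ((hasSum_euler hq n).mul_right _).congr_fun fun m => ?_
    simp only [pow_add, div_eq_mul_inv, mul_inv]
    ring
  · obtain ⟨n, t⟩ := x
    refine (((hasSum_euler hq2 n).mul_right _).mul_left _).congr_fun fun m => ?_
    simp only [div_qPoch_neg_mul]
    simp only [pow_add, pow_mul, div_eq_mul_inv, mul_inv]
    ring

theorem hasSum_euler_ag_split_head (hq : ‖q‖ < 1) (hi : 1 ≤ i) (hir : i ≤ r + 2) :
    HasSum (fun ((m, n₁₁, n₁₂, t) : ℕ × ℕ × ℕ × (Fin r → ℕ)) =>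
        q ^ ((m + 1).choose 2 + m * (n₁₁ + 2 * n₁₂) + n₁₁.choose 2 +
            2 * agExponent i (consVec (n₁₁ + 2 * n₁₂) t)) /
          (qPoch q q m * qPoch q q n₁₁ * qPoch (q ^ 2) (q ^ 2) n₁₂ *
            ∏ l, qPoch (q ^ 2) (q ^ 2) (t l)))
      (agProduct (q ^ 2) (r + 1) i / qPochInf q q) := by
  have hq2 := norm_pow_lt_one hq two_ne_zero
  have hb := invBounded_qPoch hq hq
  have hb2 := invBounded_qPoch hq2 hq2
  refine hasSum_of_fiber_fst (g := fun x => qPochInf (-q) q / qPoch (-q) q (x.1 + 2 * x.2.1) *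
    (q ^ (x.1.choose 2 + 2 * agExponent i (consVec (x.1 + 2 * x.2.1) x.2.2)) /
      (qPoch q q x.1 * qPoch (q ^ 2) (q ^ 2) x.2.1 * ∏ l, qPoch (q ^ 2) (q ^ 2) (x.2.2 l))))
    ?_ (fun x => ?_) fun hs => hasSum_of_add_two_mul hq
      (K := fun n t => qPochInf (-q) q / qPoch (-q) q n *
        (q ^ (2 * agExponent i (consVec n t)) / ∏ l, qPoch (q ^ 2) (q ^ 2) (t l))) hs
      (fun a b t => ?_) ((hasSum_core_cons hq hi hir).congr_fun fun x => ?_)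
  · refine summable_of_eq_pow_div hq (summable_weight_cons (norm_nonneg q) hq
      (summable_weight_cons (norm_nonneg q) hq (summable_weight (norm_nonneg q) hq r)))
      ((((hb.comp fun x : ℕ × ℕ × ℕ × (Fin r → ℕ) => x.1).mul
        (hb.comp fun x : ℕ × ℕ × ℕ × (Fin r → ℕ) => x.2.1)).mul
        (hb2.comp fun x : ℕ × ℕ × ℕ × (Fin r → ℕ) => x.2.2.1)).mul
        (hb2.prod_pi.comp fun x : ℕ × ℕ × ℕ × (Fin r → ℕ) => x.2.2.2)) ?_
    rintro ⟨m, a, b, t⟩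
    refine ⟨_, ?_, rfl⟩
    have h1 := le_choose_two_succ m
    have h3 := sum_le_agExponent_cons i (a + 2 * b) t
    dsimp only
    omega
  · obtain ⟨a, b, t⟩ := x
    refine ((hasSum_euler hq (a + 2 * b)).mul_right _).congr_fun fun m => ?_
    simp only [pow_add, div_eq_mul_inv, mul_inv]
    ring
  · simp only [pow_add, div_eq_mul_inv, mul_inv]
    ring
  · simp only [div_eq_mul_inv, mul_inv]
    ring

/-- Here the Euler variable itself is split: merging m₁ + 2m₂ into m gives `hasSum_euler_ag_cons`.
-/
theorem hasSum_split_euler_ag_cons (hq : ‖q‖ < 1) (hi : 1 ≤ i) (hir : i ≤ r + 2) :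
    HasSum (fun ((m₁, m₂, n₁, t) : ℕ × ℕ × ℕ × (Fin r → ℕ)) =>
        q ^ (m₁.choose 2 + (m₁ + 2 * m₂ + 1).choose 2 + (m₁ + 2 * m₂) * n₁ +
            2 * agExponent i (consVec n₁ t)) /
          (qPoch q q m₁ * qPoch (q ^ 2) (q ^ 2) m₂ * qPoch q q n₁ *
            ∏ l, qPoch (q ^ 2) (q ^ 2) (t l)))
      (agProduct (q ^ 2) (r + 1) i / qPochInf q q) := by
  have hq2 := norm_pow_lt_one hq two_ne_zero
  have hb := invBounded_qPoch hq hq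
  have hb2 := invBounded_qPoch hq2 hq2
  refine hasSum_of_add_two_mul hq
    (K := fun m (x : ℕ × (Fin r → ℕ)) =>
      q ^ ((m + 1).choose 2 + m * x.1 + 2 * agExponent i (consVec x.1 x.2)) /
        (qPoch q q x.1 * ∏ l, qPoch (q ^ 2) (q ^ 2) (x.2 l))) ?_ (fun a b x => ?_)
    ((hasSum_euler_ag_cons hq hi hir).congr_fun fun ⟨m, n, t⟩ => ?_)
  · refine summable_of_eq_pow_div hq (summable_weight_cons (norm_nonneg q) hq
      (summable_weight_cons (norm_nonneg q) hq (summable_weight (norm_nonneg q) hq r)))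
      ((((hb.comp fun x : ℕ × ℕ × ℕ × (Fin r → ℕ) => x.1).mul
        (hb2.comp fun x : ℕ × ℕ × ℕ × (Fin r → ℕ) => x.2.1)).mul
        (hb.comp fun x : ℕ × ℕ × ℕ × (Fin r → ℕ) => x.2.2.1)).mul
        (hb2.prod_pi.comp fun x : ℕ × ℕ × ℕ × (Fin r → ℕ) => x.2.2.2)) ?_
    rintro ⟨a, b, n, t⟩
    refine ⟨_, ?_, rfl⟩
    have h1 := le_choose_two_succ (a + 2 * b)
    have h3 := sum_le_agExponent_cons i n t
    dsimp only
    omega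
  · obtain ⟨n, t⟩ := x
    simp only [pow_add, div_eq_mul_inv, mul_inv]
    ring
  · simp only [div_eq_mul_inv, mul_inv]
    ring

theorem hasSum_ag_split_head (hq : ‖q‖ < 1) (hi : 1 ≤ i) (hir : i ≤ r + 2) :
    HasSum (fun ((n₁₁, n₁₂, t) : ℕ × ℕ × (Fin r → ℕ)) =>
        q ^ (n₁₁.choose 2 + agExponent i (consVec (n₁₁ + 2 * n₁₂) t)) /
          (qPoch q q n₁₁ * qPoch (q ^ 2) (q ^ 2) n₁₂ * ∏ l, qPoch q q (t l)))
      (agProduct q (r + 1) i / qPochInf q q) := by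
  have hq2 := norm_pow_lt_one hq two_ne_zero
  have hb := invBounded_qPoch hq hq
  have hb2 := invBounded_qPoch hq2 hq2
  refine hasSum_of_add_two_mul hq
    (K := fun n t => q ^ agExponent i (consVec n t) * (∏ l, qPoch q q (t l))⁻¹)
    ?_ (fun a b t => ?_) (hasSum_ag_cons hq hi hir)
  · refine summable_of_eq_pow_div hq (summable_weight_cons (norm_nonneg q) hq
      (summable_weight (norm_nonneg q) hq r))
      (((hb.comp fun x : ℕ × ℕ × (Fin r → ℕ) => x.1).mul
        (hb2.comp fun x : ℕ × ℕ × (Fin r → ℕ) => x.2.1)).mul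
        (hb.prod_pi.comp fun x : ℕ × ℕ × (Fin r → ℕ) => x.2.2)) ?_
    rintro ⟨a, b, t⟩
    refine ⟨_, ?_, rfl⟩
    have h3 := sum_le_agExponent_cons i (a + 2 * b) t
    dsimp only
    omega
  · simp only [pow_add, div_eq_mul_inv, mul_inv]
    ring

theorem hasSum_ag_split_last (hq : ‖q‖ < 1) (hi : 1 ≤ i) (hir : i ≤ r + 2) :
    HasSum (fun ((t, nk₁, nk₂) : (Fin r → ℕ) × ℕ × ℕ) =>
        q ^ (nk₁.choose 2 + agExponent i (snocVec t (nk₁ + 2 * nk₂))) /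
          ((∏ l, qPoch q q (t l)) * qPoch q q nk₁ * qPoch (q ^ 2) (q ^ 2) nk₂))
      (agProduct q (r + 1) i / qPochInf q q) := by
  have hq2 := norm_pow_lt_one hq two_ne_zero
  have hb := invBounded_qPoch hq hq
  have hb2 := invBounded_qPoch hq2 hq2
  rw [← ((Equiv.prodAssoc _ _ _).symm.trans (Equiv.prodComm (ℕ × ℕ) (Fin r → ℕ))).hasSum_iff]
  refine hasSum_of_add_two_mul hq
    (K := fun n t => q ^ agExponent i (snocVec t n) * (∏ l, qPoch q q (t l))⁻¹)
    ?_ (fun a b t => ?_) (hasSum_ag_snoc hq hi hir)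
  · refine summable_of_eq_pow_div hq (summable_weight_cons (norm_nonneg q) hq
      (summable_weight (norm_nonneg q) hq r))
      (((hb.prod_pi.comp fun x : ℕ × ℕ × (Fin r → ℕ) => x.2.2).mul
        (hb.comp fun x : ℕ × ℕ × (Fin r → ℕ) => x.1)).mul
        (hb2.comp fun x : ℕ × ℕ × (Fin r → ℕ) => x.2.1)) ?_
    rintro ⟨a, b, t⟩
    refine ⟨a.choose 2 + agExponent i (snocVec t (a + 2 * b)), ?_, rfl⟩
    have h3 := sum_le_agExponent_snoc i (a + 2 * b) t
    dsimp only
    omega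
  · simp only [Function.comp, Equiv.trans_apply, Equiv.prodAssoc_symm_apply,
      Equiv.prodComm_apply, Prod.swap_prod_mk, pow_add, div_eq_mul_inv, mul_inv]
    ring

/-- Moving q^(n(n-1)/2) out of the exponent exhibits a coefficient of `eulerSeries q`, as
`hasSum_of_add` requires. -/
theorem hasSum_core_ag_sub_choose (hq : ‖q‖ < 1) (hi : 1 ≤ i) (hir : i ≤ r + 2) :
    HasSum (fun x : ℕ × (Fin r → ℕ) => q ^ x.1.choose 2 / qPoch q q x.1 *
      (qPochInf (-q) q * (q ^ (agExponent i (consVec x.1 x.2) - x.1.choose 2) /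
        ∏ l, qPoch q q (x.2 l))))
      (qPochInf (-q) q * agProduct q (r + 1) i / qPochInf q q) := by
  rw [mul_div_assoc]
  refine ((hasSum_ag_cons hq hi hir).mul_left _).congr_fun fun x => ?_
  have h : q ^ agExponent i (consVec x.1 x.2) =
      q ^ x.1.choose 2 * q ^ (agExponent i (consVec x.1 x.2) - x.1.choose 2) := by
    rw [← pow_add, Nat.add_sub_cancel'
      ((Nat.le_add_right _ _).trans (choose_two_add_le_agExponent_cons i x.1 x.2))]
  rw [h]
  simp only [div_eq_mul_inv]
  ring

/-- Euler's sum over m turns (q;q)_a into (q²;q²)_a for a = n₁₁. With b = n₁₂, a² - a and b² are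
twice binomial coefficients, plus b in the second case: the coefficients of (-X;q²)_∞ and
(-qX;q²)_∞. In the companion series a and b exchange these roles. -/
theorem hasSum_euler_ag_sub_left (hq : ‖q‖ < 1) (hi : 1 ≤ i) (hir : i ≤ r + 2) :
    HasSum (fun ((m, n₁₁, n₁₂, t) : ℕ × ℕ × ℕ × (Fin r → ℕ)) =>
        q ^ (((m + 1).choose 2 : ℤ) + m * n₁₁ + n₁₁ ^ 2 + n₁₂ ^ 2 - n₁₁ -
            ((n₁₁ + n₁₂).choose 2 : ℤ) + agExponent i (consVec (n₁₁ + n₁₂) t)) /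
          (qPoch q q m * qPoch q q n₁₁ * qPoch (q ^ 2) (q ^ 2) n₁₂ * ∏ l, qPoch q q (t l)))
      (qPochInf (-q) q * agProduct q (r + 1) i / qPochInf q q) := by
  have hq2 := norm_pow_lt_one hq two_ne_zero
  have hb := invBounded_qPoch hq hq
  have hb2 := invBounded_qPoch hq2 hq2
  -- The same series with its exponent written in ℕ, which also settles q = 0.
  have key : HasSum (fun ((m, a, b, t) : ℕ × ℕ × ℕ × (Fin r → ℕ)) =>
        q ^ ((m + 1).choose 2 + m * a + (2 * a.choose 2 + (b + 2 * b.choose 2)) +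
          (agExponent i (consVec (a + b) t) - (a + b).choose 2)) /
          (qPoch q q m * qPoch q q a * qPoch (q ^ 2) (q ^ 2) b * ∏ l, qPoch q q (t l)))
      (qPochInf (-q) q * agProduct q (r + 1) i / qPochInf q q) := by
    refine hasSum_of_fiber_fst (g := fun x => qPochInf (-q) q / qPoch (-q) q x.1 *
      (q ^ (2 * x.1.choose 2 + (x.2.1 + 2 * x.2.1.choose 2) +
          (agExponent i (consVec (x.1 + x.2.1) x.2.2) - (x.1 + x.2.1).choose 2)) /
        (qPoch q q x.1 * (qPoch (q ^ 2) (q ^ 2) x.2.1 * ∏ l, qPoch q q (x.2.2 l)))))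
      ?_ (fun x => ?_) fun hs => hasSum_of_add hq
        (K := fun n t => qPochInf (-q) q * (q ^ (agExponent i (consVec n t) - n.choose 2) /
          ∏ l, qPoch q q (t l))) hs (fun a b t => ?_)
        (hasSum_core_ag_sub_choose hq hi hir)
    · refine summable_of_eq_pow_div hq (summable_weight_cons (norm_nonneg q) hq
        (summable_weight_cons (norm_nonneg q) hq (summable_weight (norm_nonneg q) hq r)))
        ((((hb.comp fun x : ℕ × ℕ × ℕ × (Fin r → ℕ) => x.1).mul
        (hb.comp fun x : ℕ × ℕ × ℕ × (Fin r → ℕ) => x.2.1)).mul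
        (hb2.comp fun x : ℕ × ℕ × ℕ × (Fin r → ℕ) => x.2.2.1)).mul
        (hb.prod_pi.comp fun x : ℕ × ℕ × ℕ × (Fin r → ℕ) => x.2.2.2)) ?_
      rintro ⟨m, a, b, t⟩
      refine ⟨_, ?_, rfl⟩
      have h1 := le_choose_two_succ m
      have h3 := choose_two_add_le_agExponent_cons i (a + b) t
      dsimp only
      omega
    · obtain ⟨a, b, t⟩ := x
      refine ((hasSum_euler hq a).mul_right _).congr_fun fun m => ?_
      simp only [pow_add, div_eq_mul_inv, mul_inv]
      ring
    · simp only [div_qPoch_neg_mul]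
      simp only [pow_add, pow_mul, div_eq_mul_inv, mul_inv]
      ring
  refine key.congr_fun fun ⟨m, a, b, t⟩ => ?_
  have h3 := choose_two_add_le_agExponent_cons i (a + b) t
  have ha := two_mul_choose_two a
  have hb := two_mul_choose_two b
  have he : ((m + 1).choose 2 : ℤ) + m * a + a ^ 2 + b ^ 2 - a - ((a + b).choose 2 : ℤ) +
      agExponent i (consVec (a + b) t) =
      ((((m + 1).choose 2 + m * a + (2 * a.choose 2 + (b + 2 * b.choose 2)) +
        (agExponent i (consVec (a + b) t) - (a + b).choose 2)) : ℕ) : ℤ) := by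
    push_cast [Nat.cast_sub (show (a + b).choose 2 ≤ agExponent i (consVec (a + b) t) by omega)]
    linarith
  dsimp only
  rw [he, zpow_natCast]

theorem hasSum_euler_ag_sub_right (hq : ‖q‖ < 1) (hi : 1 ≤ i) (hir : i ≤ r + 2) :
    HasSum (fun ((m, n₁₁, n₁₂, t) : ℕ × ℕ × ℕ × (Fin r → ℕ)) =>
        q ^ (((m + 1).choose 2 : ℤ) + m * n₁₁ + n₁₁ ^ 2 + n₁₂ ^ 2 - n₁₂ -
            ((n₁₁ + n₁₂).choose 2 : ℤ) + agExponent i (consVec (n₁₁ + n₁₂) t)) /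
          (qPoch q q m * qPoch q q n₁₁ * qPoch (q ^ 2) (q ^ 2) n₁₂ * ∏ l, qPoch q q (t l)))
      (qPochInf (-q) q * agProduct q (r + 1) i / qPochInf q q) := by
  have hq2 := norm_pow_lt_one hq two_ne_zero
  have hb := invBounded_qPoch hq hq
  have hb2 := invBounded_qPoch hq2 hq2
  have key : HasSum (fun ((m, a, b, t) : ℕ × ℕ × ℕ × (Fin r → ℕ)) =>
        q ^ ((m + 1).choose 2 + m * a + (a + 2 * a.choose 2 + 2 * b.choose 2) +
          (agExponent i (consVec (a + b) t) - (a + b).choose 2)) /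
          (qPoch q q m * qPoch q q a * qPoch (q ^ 2) (q ^ 2) b * ∏ l, qPoch q q (t l)))
      (qPochInf (-q) q * agProduct q (r + 1) i / qPochInf q q) := by
    refine hasSum_of_fiber_fst (g := fun x => qPochInf (-q) q / qPoch (-q) q x.1 *
      (q ^ (x.1 + 2 * x.1.choose 2 + 2 * x.2.1.choose 2 +
          (agExponent i (consVec (x.1 + x.2.1) x.2.2) - (x.1 + x.2.1).choose 2)) /
        (qPoch q q x.1 * (qPoch (q ^ 2) (q ^ 2) x.2.1 * ∏ l, qPoch q q (x.2.2 l)))))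
      ?_ (fun x => ?_) fun hs => hasSum_of_add' hq
        (K := fun n t => qPochInf (-q) q * (q ^ (agExponent i (consVec n t) - n.choose 2) /
          ∏ l, qPoch q q (t l))) hs (fun a b t => ?_)
        (hasSum_core_ag_sub_choose hq hi hir)
    · refine summable_of_eq_pow_div hq (summable_weight_cons (norm_nonneg q) hq
        (summable_weight_cons (norm_nonneg q) hq (summable_weight (norm_nonneg q) hq r)))
        ((((hb.comp fun x : ℕ × ℕ × ℕ × (Fin r → ℕ) => x.1).mul
        (hb.comp fun x : ℕ × ℕ × ℕ × (Fin r → ℕ) => x.2.1)).mul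
        (hb2.comp fun x : ℕ × ℕ × ℕ × (Fin r → ℕ) => x.2.2.1)).mul
        (hb.prod_pi.comp fun x : ℕ × ℕ × ℕ × (Fin r → ℕ) => x.2.2.2)) ?_
      rintro ⟨m, a, b, t⟩
      refine ⟨_, ?_, rfl⟩
      have h1 := le_choose_two_succ m
      have h3 := choose_two_add_le_agExponent_cons i (a + b) t
      dsimp only
      omega
    · obtain ⟨a, b, t⟩ := x
      refine ((hasSum_euler hq a).mul_right _).congr_fun fun m => ?_
      simp only [pow_add, div_eq_mul_inv, mul_inv]
      ring
    · simp only [div_qPoch_neg_mul]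
      simp only [pow_add, pow_mul, div_eq_mul_inv, mul_inv]
      ring
  refine key.congr_fun fun ⟨m, a, b, t⟩ => ?_
  have h3 := choose_two_add_le_agExponent_cons i (a + b) t
  have ha := two_mul_choose_two a
  have hb := two_mul_choose_two b
  have he : ((m + 1).choose 2 : ℤ) + m * a + a ^ 2 + b ^ 2 - b - ((a + b).choose 2 : ℤ) +
      agExponent i (consVec (a + b) t) =
      ((((m + 1).choose 2 + m * a + (a + 2 * a.choose 2 + 2 * b.choose 2) +
        (agExponent i (consVec (a + b) t) - (a + b).choose 2)) : ℕ) : ℤ) := by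
    push_cast [Nat.cast_sub (show (a + b).choose 2 ≤ agExponent i (consVec (a + b) t) by omega)]
    linarith
  dsimp only
  rw [he, zpow_natCast]

end series

end AndrewsGordon

theorem mainTheorem8 (q : ℂ) (hq : ‖q‖ < 1) (k i : ℕ) (hk : 1 ≤ k) (hi : 1 ≤ i)
    (hik : i ≤ k + 1) :
    -- (1) summation over `m, n₁` and `t = (n₂, …, n_k)`
    HasSum (fun ((m, n₁, t) : ℕ × ℕ × (Fin (k - 1) → ℕ)) =>
        q ^ ((m + 1).choose 2 + m * n₁ + 2 * agExponent i (consVec n₁ t)) /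
          (qPoch q q m * qPoch q q n₁ * ∏ l, qPoch (q ^ 2) (q ^ 2) (t l)))
      (qPochInf₃ (q ^ (2 * i)) (q ^ (4 * k + 6 - 2 * i)) (q ^ (4 * k + 6)) (q ^ (4 * k + 6)) /
        qPochInf q q) ∧
    -- (2) summation over `m`, `t = (n₁, …, n_{k-1})` and `n_k`
    HasSum (fun ((m, t, nk) : ℕ × (Fin (k - 1) → ℕ) × ℕ) =>
        q ^ ((m + 1).choose 2 + m * nk + 2 * agExponent i (snocVec t nk)) /
          (qPoch q q m * (∏ l, qPoch (q ^ 2) (q ^ 2) (t l)) * qPoch q q nk))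
      (qPochInf₃ (q ^ (2 * i)) (q ^ (4 * k + 6 - 2 * i)) (q ^ (4 * k + 6)) (q ^ (4 * k + 6)) /
        qPochInf q q) ∧
    -- (3) summation over `m₁, m₂, n₁` and `t = (n₂, …, n_k)`
    HasSum (fun ((m₁, m₂, n₁, t) : ℕ × ℕ × ℕ × (Fin (k - 1) → ℕ)) =>
        q ^ ((m₁ + 1).choose 2 + m₁ * m₂ + 2 * (m₂ + 1).choose 2 + 2 * m₂ * n₁ +
            4 * agExponent i (consVec n₁ t)) /
          (qPoch q q m₁ * qPoch q q m₂ * qPoch (q ^ 2) (q ^ 2) n₁ *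
            ∏ l, qPoch (q ^ 4) (q ^ 4) (t l)))
      (qPochInf₃ (q ^ (4 * i)) (q ^ (8 * k + 12 - 4 * i)) (q ^ (8 * k + 12)) (q ^ (8 * k + 12)) /
        qPochInf q q) ∧
    -- (4) summation over `m, n₁₁, n₁₂` and `t = (n₂, …, n_k)`, with `n₁ = n₁₁ + 2 n₁₂`
    HasSum (fun ((m, n₁₁, n₁₂, t) : ℕ × ℕ × ℕ × (Fin (k - 1) → ℕ)) =>
        q ^ ((m + 1).choose 2 + m * (n₁₁ + 2 * n₁₂) + n₁₁.choose 2 +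
            2 * agExponent i (consVec (n₁₁ + 2 * n₁₂) t)) /
          (qPoch q q m * qPoch q q n₁₁ * qPoch (q ^ 2) (q ^ 2) n₁₂ *
            ∏ l, qPoch (q ^ 2) (q ^ 2) (t l)))
      (qPochInf₃ (q ^ (2 * i)) (q ^ (4 * k + 6 - 2 * i)) (q ^ (4 * k + 6)) (q ^ (4 * k + 6)) /
        qPochInf q q) ∧
    -- (5) summation over `m₁, m₂, n₁` and `t = (n₂, …, n_k)`
    HasSum (fun ((m₁, m₂, n₁, t) : ℕ × ℕ × ℕ × (Fin (k - 1) → ℕ)) =>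
        q ^ ((m₁ + 1).choose 2 + m₁ * n₁ + 2 * (m₂ + 1).choose 2 + 2 * m₂ * n₁ +
            4 * agExponent i (consVec n₁ t)) /
          (qPoch q q m₁ * qPoch (q ^ 2) (q ^ 2) m₂ * qPoch q q n₁ *
            ∏ l, qPoch (q ^ 4) (q ^ 4) (t l)))
      (qPochInf₃ (q ^ (4 * i)) (q ^ (8 * k + 12 - 4 * i)) (q ^ (8 * k + 12)) (q ^ (8 * k + 12)) /
        qPochInf q q) ∧
    -- (6) summation over `m₁, m₂, n₁` and `t = (n₂, …, n_k)`
    HasSum (fun ((m₁, m₂, n₁, t) : ℕ × ℕ × ℕ × (Fin (k - 1) → ℕ)) =>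
        q ^ (m₁.choose 2 + (m₁ + 2 * m₂ + 1).choose 2 + (m₁ + 2 * m₂) * n₁ +
            2 * agExponent i (consVec n₁ t)) /
          (qPoch q q m₁ * qPoch (q ^ 2) (q ^ 2) m₂ * qPoch q q n₁ *
            ∏ l, qPoch (q ^ 2) (q ^ 2) (t l)))
      (qPochInf₃ (q ^ (2 * i)) (q ^ (4 * k + 6 - 2 * i)) (q ^ (4 * k + 6)) (q ^ (4 * k + 6)) /
        qPochInf q q) ∧
    -- (7) summation over `t = (n₁, …, n_{k-1})` and `nk₁, nk₂`, with `n_k = nk₁ + 2 nk₂`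
    HasSum (fun ((t, nk₁, nk₂) : (Fin (k - 1) → ℕ) × ℕ × ℕ) =>
        q ^ (nk₁.choose 2 + agExponent i (snocVec t (nk₁ + 2 * nk₂))) /
          ((∏ l, qPoch q q (t l)) * qPoch q q nk₁ * qPoch (q ^ 2) (q ^ 2) nk₂))
      (qPochInf₃ (q ^ i) (q ^ (2 * k + 3 - i)) (q ^ (2 * k + 3)) (q ^ (2 * k + 3)) /
        qPochInf q q) ∧
    -- (8) summation over `n₁₁, n₁₂` and `t = (n₂, …, n_k)`, with `n₁ = n₁₁ + 2 n₁₂`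
    HasSum (fun ((n₁₁, n₁₂, t) : ℕ × ℕ × (Fin (k - 1) → ℕ)) =>
        q ^ (n₁₁.choose 2 + agExponent i (consVec (n₁₁ + 2 * n₁₂) t)) /
          (qPoch q q n₁₁ * qPoch (q ^ 2) (q ^ 2) n₁₂ * ∏ l, qPoch q q (t l)))
      (qPochInf₃ (q ^ i) (q ^ (2 * k + 3 - i)) (q ^ (2 * k + 3)) (q ^ (2 * k + 3)) /
        qPochInf q q) ∧
    -- (9) summation over `m, n₁₁, n₁₂` and `t = (n₂, …, n_k)`,
    -- with `n₁ = n₁₁ + n₁₂`; the exponent is an integer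
    HasSum (fun ((m, n₁₁, n₁₂, t) : ℕ × ℕ × ℕ × (Fin (k - 1) → ℕ)) =>
        q ^ (((m + 1).choose 2 : ℤ) + m * n₁₁ + n₁₁ ^ 2 + n₁₂ ^ 2 - n₁₁ -
            ((n₁₁ + n₁₂).choose 2 : ℤ) + agExponent i (consVec (n₁₁ + n₁₂) t)) /
          (qPoch q q m * qPoch q q n₁₁ * qPoch (q ^ 2) (q ^ 2) n₁₂ * ∏ l, qPoch q q (t l)))
      (qPochInf (-q) q *
        qPochInf₃ (q ^ i) (q ^ (2 * k + 3 - i)) (q ^ (2 * k + 3)) (q ^ (2 * k + 3)) /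
        qPochInf q q) ∧
    -- (10) as before, with `- n₁₂` in place of `- n₁₁` in the exponent
    HasSum (fun ((m, n₁₁, n₁₂, t) : ℕ × ℕ × ℕ × (Fin (k - 1) → ℕ)) =>
        q ^ (((m + 1).choose 2 : ℤ) + m * n₁₁ + n₁₁ ^ 2 + n₁₂ ^ 2 - n₁₂ -
            ((n₁₁ + n₁₂).choose 2 : ℤ) + agExponent i (consVec (n₁₁ + n₁₂) t)) /
          (qPoch q q m * qPoch q q n₁₁ * qPoch (q ^ 2) (q ^ 2) n₁₂ * ∏ l, qPoch q q (t l)))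
      (qPochInf (-q) q *
        qPochInf₃ (q ^ i) (q ^ (2 * k + 3 - i)) (q ^ (2 * k + 3)) (q ^ (2 * k + 3)) /
        qPochInf q q) := by
  obtain ⟨r, rfl⟩ := Nat.exists_eq_add_of_le' hk
  simp only [← agProduct_pow_two, ← agProduct_pow_four]
  exact ⟨hasSum_euler_ag_cons hq hi hik, hasSum_euler_ag_snoc hq hi hik,
    hasSum_euler_euler_ag_cons hq hi hik, hasSum_euler_ag_split_head hq hi hik,
    hasSum_two_euler_ag_cons hq hi hik, hasSum_split_euler_ag_cons hq hi hik,
    hasSum_ag_split_last hq hi hik, hasSum_ag_split_head hq hi hik,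
    hasSum_euler_ag_sub_left hq hi hik, hasSum_euler_ag_sub_right hq hi hik⟩
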